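/- Let $\mathcal M_d$ denote the complex $d\times d$ matrices and $\mathcal D(\mathbb C^d)$ the states (positive semidefinite matrices of trace one); $\log$ is to base $2$. For states $\rho,\sigma$ and $\alpha\in(1,\infty)$ let $$D_\alpha(\rho\|\sigma)=\frac1{\alpha-1}\log\operatorname{tr}\Big[\big(\sigma^{\frac{1-\alpha}{2\alpha}}\rho\,\sigma^{\frac{1-\alpha}{2\alpha}}\big)^\alpha\Big]$$ if $\operatorname{supp}\rho\subseteq\operatorname{supp}\sigma$ (negative powers being taken on the support), and $D_\alpha(\rho\|\sigma)=+\infty$ otherwise. Let $D_1(\rho\|\sigma)=\operatorname{tr}[\rho(\log\rho-\log\sigma)]$ if $\operatorname{supp}\rho\subseteq\operatorname{supp}\sigma$ and $+\infty$ otherwise, and let $D_\infty(\rho\|\sigma)=D_{\max}(\rho\|\sigma)=\inf\{\lambda\ge 0:\rho\le 2^\lambda\sigma\}$, with $\inf\emptyset=+\infty$. For a state $\rho_{XY}\in\mathcal D(\mathbb C^{d_X}\otimes\mathbb C^{d_Y})$ and $\alpha\in[1,\infty]$ let $$E_\alpha^{X:Y}(\rho_{XY})=\inf\{D_\alpha(\rho_{XY}\|\sigma_{XY}):\sigma_{XY}\text{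 a separable state with respect to } X:Y\},\qquad E_{\max}^{X:Y}=E_\infty^{X:Y}.$$ For a quantum channel (completely positive trace-preserving linear map) $T:\mathcal M_{d_{A'}}\to\mathcal M_{d_{B'}}$ let $$E_{\max}(T)=\sup\{E_{\max}^{R:B'}\big((\mathrm{id}_R\otimes T)(\rho_{RA'})\big):\rho_{RA'}\in\mathcal D(\mathbb C^{d_R}\otimes\mathbb C^{d_{A'}}),\ d_R\in\mathbb N\}.$$ Theorem. For every quantum channel $T:\mathcal M_{d_{A'}}\to\mathcal M_{d_{B'}}$, all $d_A,d_B\in\mathbb N$, every state $\rho_{AA'B}\in\mathcal D(\mathbb C^{d_A}\otimes\mathbb C^{d_{A'}}\otimes\mathbb C^{d_B})$ and every $\alpha\in[1,\infty]$, $$E_\alpha^{A:BB'}\big((\mathrm{id}_A\otimes T\otimes\mathrm{id}_B)(\rho_{AA'B})\big)\le E_{\max}(T)+E_\alpha^{AA':B}(\rho_{AA'B}).$$ -/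

import Mathlib

open scoped Kronecker ENNReal ComplexOrder

namespace QEnt

/-- A quantum state: a positive semidefinite matrix of trace one. -/
def IsState {n : Type*} [Fintype n] (ρ : Matrix n n ℂ) : Prop :=
  ρ.PosSemidef ∧ ρ.trace = 1

/-- Application of `T` to the right tensor factor: `(id_R ⊗ T)(X)`. -/
def applyRight {R m n : Type*} (T : Matrix m m ℂ →ₗ[ℂ] Matrix n n ℂ)
    (X : Matrix (R × m) (R × m) ℂ) : Matrix (R × n) (R × n) ℂ :=
  Matrix.of fun x y => T (Matrix.of fun i j => X (x.1, i) (y.1, j)) x.2 y.2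

/-- Application of `T` to the middle tensor factor: `(id_R ⊗ T ⊗ id_S)(X)`. -/
def applyMiddle {R S m n : Type*} (T : Matrix m m ℂ →ₗ[ℂ] Matrix n n ℂ)
    (X : Matrix (R × m × S) (R × m × S) ℂ) : Matrix (R × n × S) (R × n × S) ℂ :=
  Matrix.of fun x y =>
    T (Matrix.of fun i j => X (x.1, i, x.2.2) (y.1, j, y.2.2)) x.2.1 y.2.1

/-- Complete positivity: `id_k ⊗ T` is positive for every `k`. -/
def IsCompletelyPositive {m n : Type*} [Fintype m] [Fintype n]
    (T : Matrix m m ℂ →ₗ[ℂ] Matrix n n ℂ) : Prop :=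
  ∀ (k : ℕ) (X : Matrix (Fin k × m) (Fin k × m) ℂ),
    X.PosSemidef → (applyRight T X).PosSemidef

/-- A quantum channel: a completely positive and trace-preserving linear map. -/
def IsChannel {m n : Type*} [Fintype m] [Fintype n]
    (T : Matrix m m ℂ →ₗ[ℂ] Matrix n n ℂ) : Prop :=
  IsCompletelyPositive T ∧ ∀ X, (T X).trace = X.trace

/-- Separable states of a bipartite system: finite mixtures of product states. -/
def IsSeparable {a b : Type*} [Fintype a] [Fintype b]
    (σ : Matrix (a × b) (a × b) ℂ) : Prop :=
  ∃ (k : ℕ) (p : Fin k → ℝ) (γ : Fin k → Matrix a a ℂ) (φ : Fin k → Matrix b b ℂ),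
    (∀ i, 0 ≤ p i) ∧ ∑ i, p i = 1 ∧ (∀ i, IsState (γ i)) ∧ (∀ i, IsState (φ i)) ∧
      σ = ∑ i, (p i : ℂ) • (γ i ⊗ₖ φ i)

/-- The support of a Hermitian matrix, that is, the orthogonal complement of its kernel,
which is its range. -/
def supp {n : Type*} [Fintype n] (ρ : Matrix n n ℂ) : Submodule ℂ (n → ℂ) :=
  LinearMap.range ρ.mulVecLin

noncomputable section

/-- Powers of positive semidefinite matrices by functional calculus. As `0 ^ r = 0` for real
`r ≠ 0`, negative powers are powers of the pseudo-inverse. -/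
def mpow {n : Type*} [Fintype n] [DecidableEq n] (ρ : Matrix n n ℂ) (r : ℝ) : Matrix n n ℂ :=
  cfc (fun x : ℝ => x ^ r) ρ

/-- Base-two logarithm of a positive semidefinite matrix by functional calculus, taken on the
support (`Real.logb 2 0 = 0`). -/
def mlog {n : Type*} [Fintype n] [DecidableEq n] (ρ : Matrix n n ℂ) : Matrix n n ℂ :=
  cfc (fun x : ℝ => Real.logb 2 x) ρ

/-- The max-relative entropy `inf {t ≥ 0 : ρ ≤ 2 ^ t σ}`, which is `⊤` if there is no such `t`. -/
def Dmax {n : Type*} [Fintype n] (ρ σ : Matrix n n ℂ) : EReal :=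
  ⨅ (t : ℝ) (_ : 0 ≤ t ∧ ((((2 : ℝ) ^ t : ℝ) : ℂ) • σ - ρ).PosSemidef), (t : EReal)

open Classical in
/-- The relative entropy `tr [ρ (log ρ - log σ)]`, and `⊤` without inclusion of supports. -/
def relEntropy {n : Type*} [Fintype n] [DecidableEq n] (ρ σ : Matrix n n ℂ) : EReal :=
  if supp ρ ≤ supp σ then (((ρ * (mlog ρ - mlog σ)).trace.re : ℝ) : EReal) else ⊤

open Classical in
/-- The sandwiched Rényi divergence of order `α`, for real `α > 1`. -/
def sandwichedRenyi {n : Type*} [Fintype n] [DecidableEq n] (α : ℝ)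
    (ρ σ : Matrix n n ℂ) : EReal :=
  if supp ρ ≤ supp σ then
    ((1 / (α - 1) * Real.logb 2
      (mpow (mpow σ ((1 - α) / (2 * α)) * ρ * mpow σ ((1 - α) / (2 * α))) α).trace.re : ℝ) : EReal)
  else ⊤

/-- The divergences `D_α` for `α ∈ [1, ∞]`: relative entropy at `α = 1`, max-relative entropy
at `α = ∞`, and the sandwiched Rényi divergence in between. -/
def Dalpha {n : Type*} [Fintype n] [DecidableEq n] (α : ℝ≥0∞) (ρ σ : Matrix n n ℂ) : EReal :=
  if α = 1 then relEntropy ρ σ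
  else if α = ∞ then Dmax ρ σ
  else sandwichedRenyi α.toReal ρ σ

/-- The `α`-relative entropy of entanglement of a bipartite state. -/
def Ealpha {a b : Type*} [Fintype a] [DecidableEq a] [Fintype b] [DecidableEq b]
    (α : ℝ≥0∞) (ρ : Matrix (a × b) (a × b) ℂ) : EReal :=
  ⨅ (σ : Matrix (a × b) (a × b) ℂ) (_ : IsSeparable σ), Dalpha α ρ σ

/-- The max-relative entropy of entanglement of a bipartite state. -/
def Emax {a b : Type*} [Fintype a] [Fintype b] (ρ : Matrix (a × b) (a × b) ℂ) : EReal :=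
  ⨅ (σ : Matrix (a × b) (a × b) ℂ) (_ : IsSeparable σ), Dmax ρ σ

/-- The max-relative entropy of entanglement of a channel: the supremum over all dimensions `d`
of the reference system and all input states. -/
def EmaxChannel {m n : Type*} [Fintype m] [Fintype n]
    (T : Matrix m m ℂ →ₗ[ℂ] Matrix n n ℂ) : EReal :=
  ⨆ (d : ℕ) (ρ : Matrix (Fin d × m) (Fin d × m) ℂ) (_ : IsState ρ), Emax (applyRight T ρ)

end

end QEnt

/-!
For Kraus operators `K` with `∑ k, (K k)ᴴ * K k = 1` put `Φ X = ∑ k, K k * X * (K k)ᴴ`. Everything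
rests on the data-processed triangle inequality `Dalpha_krausMap_le`: if `Φ σ ≤ 2 ^ t τ`, then
`D_α(Φ ρ‖τ) ≤ t + D_α(ρ‖σ)`. For `α = ∞` it is the positivity of `Φ`. In all other cases it comes
from one entire function, `interpFun`:

`f z = tr [H ^ (a (1 - z)) σ ^ (z / 2) Φ†(τ ^ (-z / 2) G ^ (a z) τ ^ (-z / 2)) σ ^ (z / 2)]`.

On `re z = 0` the imaginary powers and the unital map `Φ†` are contractions, hence
`‖f z‖ ≤ tr (H ^ a)`; on `re z = 1` the map `X ↦ τ ^ (-1/2) Φ(σ ^ (1/2) X σ ^ (1/2)) τ ^ (-1/2)` has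
norm at most `2 ^ t`, hence `‖f z‖ ≤ 2 ^ t tr (G ^ a)`. Both bounds are instances of
`norm_krausMap_le`, and the three lines theorem gives `norm_interpFun_le`.

* For `1 < α < ∞` take `a = α`, `s = (1 - α) / (2 α)`, `H = σ ^ s ρ σ ^ s` and
  `G = τ ^ s Φ(ρ) τ ^ s`. At `x = 1 - 1 / α` one has `f x = tr (G ^ α)`, so the three lines bound
  reads `tr (G ^ α) ≤ tr (H ^ α) ^ (1 / α) * (2 ^ t tr (G ^ α)) ^ (1 - 1 / α)`, which rearranges to
  the claim.
* For `α = 1` take `a = 1`, `H = ρ` and `G = Φ ρ`. Then `‖f x‖ ≤ 2 ^ (t x)` on `[0, 1]` with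
  equality at `x = 0`, and `f' 0 = log 2 * (D(Φ ρ‖τ) - D(ρ‖σ))`. Comparing derivatives at `0`
  gives the claim.

Neither duality of Schatten norms nor operator monotonicity is needed.

For the theorem let `σ = ∑ i, p i • (γ i ⊗ φ i)` be separable for `AA' : B`, and let
`l > EmaxChannel T`. Each `(id ⊗ T) (γ i)` is at most `2 ^ l ξ i` with `ξ i` separable for
`A : B'`, so `(id ⊗ T ⊗ id) σ ≤ 2 ^ l τ` with `τ = ∑ i, p i • (ξ i ⊗ φ i)`, which is separable for
`A : B'B`.
The triangle inequality for `Φ = id ⊗ T ⊗ id` and the infimum over `σ` and `l` finish the proof.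
That `D_α` is nonnegative on states, which is data processing under the trace, excludes the sum
`⊤ + ⊥` in `EReal`.
-/

namespace QEnt

open scoped Matrix.Norms.L2Operator

/-! ### Complex powers and logarithms on supports -/

section SpectralFunctions

variable {n : Type*} [Fintype n] [DecidableEq n] {A : Matrix n n ℂ}

/-- The function `g` of a positive semidefinite matrix, computed in an eigenbasis. In contrast to
`cfc` on Hermitian matrices, `g` may take complex values. -/
noncomputable def specFun (hA : A.PosSemidef) (g : ℝ → ℂ) : Matrix n n ℂ :=
  (hA.1.eigenvectorUnitary : Matrix n n ℂ) *
    Matrix.diagonal (fun i => g (hA.1.eigenvalues i)) *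
    star (hA.1.eigenvectorUnitary : Matrix n n ℂ)

lemma specFun_congr (hA : A.PosSemidef) {g h : ℝ → ℂ} (H : ∀ x, 0 ≤ x → g x = h x) :
    specFun hA g = specFun hA h := by
  unfold specFun
  congr 3
  funext i
  exact H _ (hA.eigenvalues_nonneg i)

lemma specFun_mul (hA : A.PosSemidef) (g h : ℝ → ℂ) :
    specFun hA g * specFun hA h = specFun hA (fun x => g x * h x) := by
  unfold specFun
  have hU : star (hA.1.eigenvectorUnitary : Matrix n n ℂ) *
    (hA.1.eigenvectorUnitary : Matrix n n ℂ) = 1 := Unitary.coe_star_mul_self _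
  calc _ = (hA.1.eigenvectorUnitary : Matrix n n ℂ) *
      Matrix.diagonal (fun i => g (hA.1.eigenvalues i)) *
      (star (hA.1.eigenvectorUnitary : Matrix n n ℂ) *
        (hA.1.eigenvectorUnitary : Matrix n n ℂ)) *
      Matrix.diagonal (fun i => h (hA.1.eigenvalues i)) *
      star (hA.1.eigenvectorUnitary : Matrix n n ℂ) := by simp only [Matrix.mul_assoc]
    _ = _ := by
      rw [hU, Matrix.mul_one, Matrix.mul_assoc _ (Matrix.diagonal _) (Matrix.diagonal _),
        Matrix.diagonal_mul_diagonal]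

lemma specFun_conjTranspose (hA : A.PosSemidef) (g : ℝ → ℂ) :
    (specFun hA g).conjTranspose = specFun hA (fun x => star (g x)) := by
  unfold specFun
  rw [Matrix.conjTranspose_mul, Matrix.conjTranspose_mul, Matrix.diagonal_conjTranspose,
    ← Matrix.star_eq_conjTranspose (star _), star_star, Matrix.star_eq_conjTranspose,
    Matrix.mul_assoc]
  rfl

lemma cfc_eq_specFun (hA : A.PosSemidef) (g : ℝ → ℝ) :
    cfc g A = specFun hA (fun x => (g x : ℂ)) := by
  rw [hA.1.cfc_eq, Matrix.IsHermitian.cfc, Unitary.conjStarAlgAut_apply]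
  rfl

lemma specFun_id (hA : A.PosSemidef) : specFun hA (fun x => (x : ℂ)) = A := by
  have := cfc_eq_specFun hA (fun x => x)
  rw [← this]
  exact cfc_id' ℝ A hA.1

lemma norm_specFun_le (hA : A.PosSemidef) (g : ℝ → ℂ) {c : ℝ} (hc : 0 ≤ c)
    (H : ∀ i, ‖g (hA.1.eigenvalues i)‖ ≤ c) : ‖specFun hA g‖ ≤ c := by
  unfold specFun
  have hU : (hA.1.eigenvectorUnitary : Matrix n n ℂ) ∈ unitary (Matrix n n ℂ) :=
    hA.1.eigenvectorUnitary.2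
  rw [CStarRing.norm_mul_mem_unitary _ (Unitary.star_mem hU),
    CStarRing.norm_mem_unitary_mul _ hU, Matrix.l2_opNorm_diagonal]
  exact (pi_norm_le_iff_of_nonneg hc).2 H

lemma hasDerivAt_specFun (hA : A.PosSemidef) {g : ℂ → ℝ → ℂ} {g' : ℝ → ℂ} {z : ℂ}
    (H : ∀ x, HasDerivAt (fun w => g w x) (g' x) z) :
    HasDerivAt (fun w => specFun hA (g w)) (specFun hA g') z := by
  unfold specFun
  refine HasDerivAt.mul_const (HasDerivAt.const_mul _ ?_) _
  have h1 : HasDerivAt (fun w => fun i => g w (hA.1.eigenvalues i))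
      (fun i => g' (hA.1.eigenvalues i)) z := hasDerivAt_pi.2 fun i => H _
  exact ((Matrix.diagonalLinearMap n ℂ ℂ).toContinuousLinearMap.hasFDerivAt
    (x := fun i => g z (hA.1.eigenvalues i))).comp_hasDerivAt z h1

/-- The complex power of a positive semidefinite matrix on its support, extended by zero on the
kernel. The extension is by zero for every exponent, so `suppPow hA 0` is the projection onto
the support, and `z ↦ suppPow hA z` is entire. -/
noncomputable def suppPow (hA : A.PosSemidef) (z : ℂ) : Matrix n n ℂ :=
  specFun hA (fun x => if x = 0 then 0 else Complex.exp (z * (Real.log x : ℂ)))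

lemma suppPow_mul_suppPow (hA : A.PosSemidef) (z w : ℂ) :
    suppPow hA z * suppPow hA w = suppPow hA (z + w) := by
  unfold suppPow
  rw [specFun_mul]
  congr 1
  funext x
  split_ifs
  · simp
  · rw [add_mul, Complex.exp_add]

lemma suppPow_conjTranspose (hA : A.PosSemidef) (z : ℂ) :
    (suppPow hA z).conjTranspose = suppPow hA (star z) := by
  unfold suppPow
  rw [specFun_conjTranspose]
  congr 1
  funext x
  split_ifs
  · simp
  · simp [← Complex.exp_conj]

lemma suppPow_one (hA : A.PosSemidef) : suppPow hA 1 = A := by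
  conv_rhs => rw [← specFun_id hA]
  refine specFun_congr hA fun x hx => ?_
  split_ifs with h
  · simp [h]
  · rw [one_mul, ← Complex.ofReal_exp, Real.exp_log (lt_of_le_of_ne hx (Ne.symm h))]

lemma suppPow_ofReal (hA : A.PosSemidef) {r : ℝ} (hr : r ≠ 0) :
    suppPow hA (r : ℂ) = mpow A r := by
  unfold mpow
  rw [cfc_eq_specFun hA]
  refine specFun_congr hA fun x hx => ?_
  split_ifs with h
  · simp [h, Real.zero_rpow hr]
  · rw [Real.rpow_def_of_pos (lt_of_le_of_ne hx (Ne.symm h)), mul_comm (Real.log x)]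
    push_cast
    rfl

lemma posSemidef_suppPow_ofReal (hA : A.PosSemidef) (r : ℝ) :
    (suppPow hA (r : ℂ)).PosSemidef := by
  have h := suppPow_mul_suppPow hA ((r / 2 : ℝ) : ℂ) ((r / 2 : ℝ) : ℂ)
  have h2 := suppPow_conjTranspose hA ((r / 2 : ℝ) : ℂ)
  rw [Complex.star_def, Complex.conj_ofReal] at h2
  rw [← Complex.ofReal_add, add_halves] at h
  rw [← h]
  nth_rw 1 [← h2]
  exact Matrix.posSemidef_conjTranspose_mul_self _

lemma norm_suppPow_le (hA : A.PosSemidef) (z : ℂ) :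
    ‖suppPow hA z‖ ≤ Real.exp (|z.re| * ∑ i, |Real.log (hA.1.eigenvalues i)|) := by
  refine norm_specFun_le hA _ (Real.exp_pos _).le fun i => ?_
  split_ifs
  · simpa using (Real.exp_pos _).le
  · rw [Complex.norm_exp, Complex.re_mul_ofReal]
    refine Real.exp_le_exp.2 ((le_abs_self _).trans ?_)
    rw [abs_mul]
    gcongr
    exact Finset.single_le_sum (f := fun i => |Real.log (hA.1.eigenvalues i)|)
      (fun _ _ => abs_nonneg _) (Finset.mem_univ i)

lemma norm_suppPow_le_one (hA : A.PosSemidef) {z : ℂ} (hz : z.re = 0) :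
    ‖suppPow hA z‖ ≤ 1 := by
  simpa [hz] using norm_suppPow_le hA z

lemma hasDerivAt_suppPow (hA : A.PosSemidef) (z : ℂ) :
    HasDerivAt (suppPow hA) (suppPow hA z * specFun hA (fun x => (Real.log x : ℂ))) z := by
  unfold suppPow
  rw [specFun_mul]
  refine hasDerivAt_specFun hA fun x => ?_
  by_cases h : x = 0
  · simpa [h] using hasDerivAt_const z (0 : ℂ)
  · simp only [h, if_false]
    simpa using ((hasDerivAt_id z).mul_const (Real.log x : ℂ)).cexp

lemma suppPow_zero_mul_suppPow (hA : A.PosSemidef) (z : ℂ) :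
    suppPow hA 0 * suppPow hA z = suppPow hA z := by
  rw [suppPow_mul_suppPow, zero_add]

lemma suppPow_mul_suppPow_zero (hA : A.PosSemidef) (z : ℂ) :
    suppPow hA z * suppPow hA 0 = suppPow hA z := by
  rw [suppPow_mul_suppPow, add_zero]

lemma suppPow_zero_mul_self (hA : A.PosSemidef) : suppPow hA 0 * A = A := by
  have := suppPow_zero_mul_suppPow hA 1
  rwa [suppPow_one] at this

lemma self_mul_suppPow_zero (hA : A.PosSemidef) : A * suppPow hA 0 = A := by
  have := suppPow_mul_suppPow_zero hA 1
  rwa [suppPow_one] at this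

lemma suppPow_zero_conjTranspose (hA : A.PosSemidef) :
    (suppPow hA 0).conjTranspose = suppPow hA 0 := by
  simp [suppPow_conjTranspose]

lemma suppPow_neg_one_mul_self (hA : A.PosSemidef) : suppPow hA (-1) * A = suppPow hA 0 := by
  have := suppPow_mul_suppPow hA (-1) 1
  rwa [suppPow_one, neg_add_cancel] at this

lemma self_mul_suppPow_neg_one (hA : A.PosSemidef) : A * suppPow hA (-1) = suppPow hA 0 := by
  have := suppPow_mul_suppPow hA 1 (-1)
  rwa [suppPow_one, add_neg_cancel] at this

/-- Both logarithms vanish on the kernel, since `Real.log 0 = 0 = Real.logb 2 0`. -/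
lemma specFun_log_eq (hA : A.PosSemidef) :
    specFun hA (fun x => (Real.log x : ℂ)) = (Real.log 2 : ℂ) • mlog A := by
  have h2 : Real.log 2 ≠ 0 := (Real.log_pos one_lt_two).ne'
  unfold mlog
  rw [cfc_eq_specFun hA]
  unfold specFun
  rw [← Matrix.smul_mul, ← Matrix.mul_smul, ← Matrix.diagonal_smul]
  congr 3
  funext i
  simp only [Pi.smul_apply, smul_eq_mul, ← Complex.ofReal_mul, Real.logb]
  rw [mul_div_cancel₀ _ h2]

lemma suppPow_zero_mul_log (hA : A.PosSemidef) :
    suppPow hA 0 * specFun hA (fun x => (Real.log x : ℂ)) =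
      specFun hA (fun x => (Real.log x : ℂ)) := by
  unfold suppPow
  rw [specFun_mul]
  congr 1
  funext x
  by_cases h : x = 0 <;> simp [h]

lemma log_mul_self_comm (hA : A.PosSemidef) :
    specFun hA (fun x => (Real.log x : ℂ)) * A = A * specFun hA (fun x => (Real.log x : ℂ)) := by
  have h : specFun hA (fun x => (Real.log x : ℂ)) * specFun hA (fun x => (x : ℂ)) =
      specFun hA (fun x => (x : ℂ)) * specFun hA (fun x => (Real.log x : ℂ)) := by
    rw [specFun_mul, specFun_mul]
    simp only [mul_comm]
  rwa [specFun_id] at h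

/-- Inclusion of supports, expressed by the projection onto the larger support. -/
lemma supp_le_supp_iff {B : Matrix n n ℂ} (hB : B.PosSemidef) :
    supp A ≤ supp B ↔ suppPow hB 0 * A = A := by
  constructor
  · intro h
    ext i j
    have hj : A.mulVec (Pi.single j 1) ∈ supp B := h ⟨_, rfl⟩
    obtain ⟨v, hv⟩ := hj
    have h1 : (suppPow hB 0 * A).mulVec (Pi.single j 1) = A.mulVec (Pi.single j 1) := by
      rw [← Matrix.mulVec_mulVec, ← hv, Matrix.mulVecLin_apply, Matrix.mulVec_mulVec,
        suppPow_zero_mul_self]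
    simpa using congrFun h1 i
  · rintro h _ ⟨v, rfl⟩
    refine ⟨(suppPow hB (-1) * A).mulVec v, ?_⟩
    rw [Matrix.mulVecLin_apply, Matrix.mulVecLin_apply, Matrix.mulVec_mulVec,
      ← Matrix.mul_assoc, self_mul_suppPow_neg_one, h]

end SpectralFunctions

/-! ### Operator norm bounds for completely positive maps -/

section Contractions

variable {n m κ : Type*} [Fintype n] [Fintype κ]

/-- The completely positive map `X ↦ ∑ k, K k * X * (K k)ᴴ` with Kraus operators `K`. Its adjoint
for the trace pairing is `krausMap fun k => (K k)ᴴ`. -/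
def krausMap (K : κ → Matrix m n ℂ) : Matrix n n ℂ →ₗ[ℂ] Matrix m m ℂ where
  toFun X := ∑ k, K k * X * (K k).conjTranspose
  map_add' X Y := by simp only [Matrix.mul_add, Matrix.add_mul, Finset.sum_add_distrib]
  map_smul' c X := by simp [Finset.smul_sum]

lemma krausMap_apply (K : κ → Matrix m n ℂ) (X : Matrix n n ℂ) :
    krausMap K X = ∑ k, K k * X * (K k).conjTranspose := rfl

lemma trace_mul_krausMap_adjoint [Fintype m] (K : κ → Matrix m n ℂ)
    (X : Matrix n n ℂ) (Y : Matrix m m ℂ) :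
    (X * krausMap (fun k => (K k).conjTranspose) Y).trace = (krausMap K X * Y).trace := by
  simp only [krausMap_apply, Matrix.mul_sum, Matrix.sum_mul, Matrix.trace_sum,
    Matrix.conjTranspose_conjTranspose]
  refine Finset.sum_congr rfl fun k _ => ?_
  rw [← Matrix.mul_assoc, Matrix.trace_mul_comm]
  simp only [Matrix.mul_assoc]

lemma posSemidef_krausMap [Fintype m] (K : κ → Matrix m n ℂ)
    {X : Matrix n n ℂ} (hX : X.PosSemidef) :
    (krausMap K X).PosSemidef :=
  Matrix.posSemidef_sum _ fun k _ => hX.mul_mul_conjTranspose_same (K k)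

lemma mul_krausMap_mul [Fintype m] (K : κ → Matrix m n ℂ) (X S : Matrix n n ℂ) (R : Matrix m m ℂ) :
    R * krausMap K (S * X * S.conjTranspose) * R.conjTranspose =
      krausMap (fun k => R * K k * S) X := by
  simp only [krausMap_apply, Matrix.mul_sum, Matrix.sum_mul, Matrix.conjTranspose_mul,
    Matrix.mul_assoc]

variable [DecidableEq n] [Fintype m] [DecidableEq m]

section Order

open scoped MatrixOrder

lemma norm_le_of_smul_one_sub_posSemidef {X : Matrix n n ℂ} (hX : X.PosSemidef) {c : ℝ}
    (hc : 0 ≤ c) (h : ((c : ℂ) • (1 : Matrix n n ℂ) - X).PosSemidef) : ‖X‖ ≤ c := by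
  refine (CStarAlgebra.norm_le_iff_le_algebraMap X hc hX.nonneg).2 ?_
  rw [Matrix.le_iff, Algebra.algebraMap_eq_smul_one]
  exact h

lemma one_sub_conjTranspose_mul_self_posSemidef {X : Matrix n n ℂ} (hX : ‖X‖ ≤ 1) :
    (1 - X.conjTranspose * X).PosSemidef := by
  have h : ‖X.conjTranspose * X‖ ≤ 1 := by
    rw [Matrix.l2_opNorm_conjTranspose_mul_self]
    exact mul_le_one₀ hX (norm_nonneg _) hX
  exact (CStarAlgebra.norm_le_one_iff_of_nonneg _
    (Matrix.posSemidef_conjTranspose_mul_self X).nonneg).1 h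

end Order

lemma norm_one_kronecker_le [DecidableEq κ] {C : Matrix n n ℂ} (hC : ‖C‖ ≤ 1) :
    ‖(1 : Matrix κ κ ℂ) ⊗ₖ C‖ ≤ 1 := by
  have h1 : (1 - ((1 : Matrix κ κ ℂ) ⊗ₖ C).conjTranspose *
      ((1 : Matrix κ κ ℂ) ⊗ₖ C)).PosSemidef := by
    have e : 1 - ((1 : Matrix κ κ ℂ) ⊗ₖ C).conjTranspose * ((1 : Matrix κ κ ℂ) ⊗ₖ C) =
        (1 : Matrix κ κ ℂ) ⊗ₖ (1 - C.conjTranspose * C) := by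
      rw [Matrix.conjTranspose_kronecker, ← Matrix.mul_kronecker_mul, Matrix.conjTranspose_one,
        Matrix.mul_one, sub_eq_iff_eq_add, ← Matrix.kronecker_add, sub_add_cancel,
        Matrix.one_kronecker_one]
    rw [e]
    exact Matrix.PosSemidef.one.kronecker (one_sub_conjTranspose_mul_self_posSemidef hC)
  have h2 := norm_le_of_smul_one_sub_posSemidef
    (Matrix.posSemidef_conjTranspose_mul_self ((1 : Matrix κ κ ℂ) ⊗ₖ C)) zero_le_one
    (by simpa using h1)
  rw [Matrix.l2_opNorm_conjTranspose_mul_self] at h2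
  nlinarith [norm_nonneg ((1 : Matrix κ κ ℂ) ⊗ₖ C)]

/-- A completely positive map with `krausMap L 1 ≤ c` has norm at most `c`: writing the `L k` as
the blocks of a single row `R`, it is `X ↦ R (1 ⊗ X) Rᴴ` and `‖R‖² = ‖R Rᴴ‖ ≤ c`. -/
lemma norm_krausMap_le [DecidableEq κ] (L : κ → Matrix m n ℂ) {c : ℝ} (hc : 0 ≤ c)
    (hL : ((c : ℂ) • (1 : Matrix m m ℂ) - krausMap L 1).PosSemidef)
    {C : Matrix n n ℂ} (hC : ‖C‖ ≤ 1) : ‖krausMap L C‖ ≤ c := by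
  set R : Matrix m (κ × n) ℂ := Matrix.of fun i p => L p.1 i p.2 with hR
  have hmul : ∀ X : Matrix n n ℂ,
      R * ((1 : Matrix κ κ ℂ) ⊗ₖ X) * R.conjTranspose = krausMap L X := by
    intro X
    ext i j
    simp [hR, krausMap_apply, Matrix.mul_apply, Matrix.sum_apply, Fintype.sum_prod_type,
      Matrix.one_apply, Finset.sum_mul]
  have h1 : R * R.conjTranspose = krausMap L 1 := by
    rw [← hmul 1, Matrix.one_kronecker_one, Matrix.mul_one]
  have h2 : ‖R‖ * ‖R‖ ≤ c := by
    rw [← Matrix.l2_opNorm_conjTranspose R, ← Matrix.l2_opNorm_conjTranspose_mul_self,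
      Matrix.conjTranspose_conjTranspose, h1]
    exact norm_le_of_smul_one_sub_posSemidef (posSemidef_krausMap L .one) hc hL
  rw [← hmul C]
  calc _ ≤ ‖R * ((1 : Matrix κ κ ℂ) ⊗ₖ C)‖ * ‖R.conjTranspose‖ := Matrix.l2_opNorm_mul _ _
    _ ≤ (‖R‖ * ‖(1 : Matrix κ κ ℂ) ⊗ₖ C‖) * ‖R.conjTranspose‖ := by
      gcongr
      exact Matrix.l2_opNorm_mul _ _
    _ ≤ (‖R‖ * 1) * ‖R‖ := by
      rw [Matrix.l2_opNorm_conjTranspose]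
      gcongr
      exact norm_one_kronecker_le hC
    _ ≤ c := by rwa [mul_one]

lemma norm_entry_le (X : Matrix n n ℂ) (i j : n) : ‖X i j‖ ≤ ‖X‖ := by
  have h := Matrix.l2_opNorm_mulVec X (EuclideanSpace.single j 1)
  have h2 := PiLp.norm_apply_le (WithLp.toLp 2 (X.mulVec (EuclideanSpace.single j (1 : ℂ)))) i
  simp at h h2
  exact h2.trans h

/-- The trace pairing with a positive semidefinite matrix is bounded by the operator norm. -/
lemma norm_trace_mul_le {B : Matrix n n ℂ} (hB : B.PosSemidef) (X : Matrix n n ℂ) :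
    ‖(B * X).trace‖ ≤ B.trace.re * ‖X‖ := by
  set U : Matrix n n ℂ := (hB.1.eigenvectorUnitary : Matrix n n ℂ) with hU
  have hU' : U ∈ unitary (Matrix n n ℂ) := hB.1.eigenvectorUnitary.2
  have h1 : (B * X).trace = ∑ i, (hB.1.eigenvalues i : ℂ) * (star U * X * U) i i := by
    conv_lhs => rw [← specFun_id hB]
    unfold specFun
    rw [Matrix.mul_assoc, Matrix.mul_assoc, Matrix.trace_mul_comm, Matrix.mul_assoc,
      Matrix.trace]
    simp [Matrix.diagonal_mul, hU]
  have h2 : ‖star U * X * U‖ = ‖X‖ := by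
    rw [CStarRing.norm_mul_mem_unitary _ hU',
      CStarRing.norm_mem_unitary_mul _ (Unitary.star_mem hU')]
  have h3 : B.trace.re = ∑ i, hB.1.eigenvalues i := by
    rw [hB.1.trace_eq_sum_eigenvalues]
    simp
  rw [h1, h3, Finset.sum_mul]
  refine (norm_sum_le _ _).trans (Finset.sum_le_sum fun i _ => ?_)
  rw [norm_mul, ← h2, Complex.norm_real, Real.norm_of_nonneg (hB.eigenvalues_nonneg i)]
  exact mul_le_mul_of_nonneg_left (norm_entry_le _ i i) (hB.eigenvalues_nonneg i)

lemma norm_mul_le_one {X Y : Matrix n n ℂ} (hX : ‖X‖ ≤ 1) (hY : ‖Y‖ ≤ 1) : ‖X * Y‖ ≤ 1 :=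
  (norm_mul_le X Y).trans (mul_le_one₀ hX (norm_nonneg _) hY)

lemma posSemidef_one_sub_suppPow_zero {A : Matrix n n ℂ} (hA : A.PosSemidef) :
    (1 - suppPow hA 0).PosSemidef := by
  have h : (1 - suppPow hA 0) = (1 - suppPow hA 0).conjTranspose * (1 - suppPow hA 0) := by
    rw [Matrix.conjTranspose_sub, suppPow_zero_conjTranspose, Matrix.conjTranspose_one,
      Matrix.sub_mul, Matrix.one_mul, Matrix.mul_sub, Matrix.mul_one, suppPow_zero_mul_suppPow,
      sub_self, sub_zero]
  rw [h]
  exact Matrix.posSemidef_conjTranspose_mul_self _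

end Contractions

/-! ### The interpolating function -/

section ThreeLines

variable {n m κ : Type*} [Fintype n] [DecidableEq n] [Fintype m] [DecidableEq m]
  [Fintype κ] {H σ : Matrix n n ℂ} {G τ : Matrix m m ℂ}

/-- The entire function
`z ↦ tr [H ^ (a (1 - z)) σ ^ (z / 2) Φ†(τ ^ (-z / 2) G ^ (a z) τ ^ (-z / 2)) σ ^ (z / 2)]`
for `Φ = krausMap K`, all powers being taken on supports. -/
noncomputable def interpFun (K : κ → Matrix m n ℂ) (hH : H.PosSemidef) (hσ : σ.PosSemidef)
    (hG : G.PosSemidef) (hτ : τ.PosSemidef) (a : ℝ) (z : ℂ) : ℂ :=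
  (suppPow hσ (z / 2) * suppPow hH (a * (1 - z)) * suppPow hσ (z / 2) *
    krausMap (fun k => (K k).conjTranspose)
      (suppPow hτ (-(z / 2)) * suppPow hG (a * z) * suppPow hτ (-(z / 2)))).trace

variable (K : κ → Matrix m n ℂ) (hH : H.PosSemidef) (hσ : σ.PosSemidef)
    (hG : G.PosSemidef) (hτ : τ.PosSemidef) (a : ℝ)

/-- On the line `re z = 0` all powers but `H ^ a` are contractions, and `Φ†` is unital. -/
lemma norm_interpFun_le_of_re_eq_zero [DecidableEq κ] (hK : ∑ k, (K k).conjTranspose * K k = 1)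
    {z : ℂ} (hz : z.re = 0) :
    ‖interpFun K hH hσ hG hτ a z‖ ≤ (suppPow hH (a : ℂ)).trace.re := by
  have hz2 : (z / 2).re = 0 := by simp [hz]
  have hz3 : (-(z / 2)).re = 0 := by simp [hz]
  have hz4 : ((a : ℂ) * z).re = 0 := by simp [hz]
  have hz5 : (-((a : ℂ) * z)).re = 0 := by simp [hz]
  have h1 : suppPow hH (a * (1 - z)) = suppPow hH a * suppPow hH (-(a * z)) := by
    rw [suppPow_mul_suppPow]
    congr 1
    ring
  unfold interpFun
  rw [h1]
  set Y := krausMap (fun k => (K k).conjTranspose)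
      (suppPow hτ (-(z / 2)) * suppPow hG (a * z) * suppPow hτ (-(z / 2))) with hY
  have hYn : ‖Y‖ ≤ 1 := by
    refine norm_krausMap_le _ zero_le_one ?_ (norm_mul_le_one (norm_mul_le_one
      (norm_suppPow_le_one hτ hz3) (norm_suppPow_le_one hG hz4)) (norm_suppPow_le_one hτ hz3))
    simpa [krausMap_apply, hK] using Matrix.PosSemidef.zero
  have h2 : (suppPow hσ (z / 2) * (suppPow hH a * suppPow hH (-(a * z))) * suppPow hσ (z / 2) *
      Y).trace = (suppPow hH a * (suppPow hH (-(a * z)) * suppPow hσ (z / 2) * Y *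
        suppPow hσ (z / 2))).trace := by
    simp only [Matrix.mul_assoc]
    rw [Matrix.trace_mul_comm]
    simp only [Matrix.mul_assoc]
  rw [h2]
  refine (norm_trace_mul_le (posSemidef_suppPow_ofReal hH a) _).trans ?_
  refine mul_le_of_le_one_right
    (Complex.le_def.1 (posSemidef_suppPow_ofReal hH a).trace_nonneg).1 ?_
  exact norm_mul_le_one (norm_mul_le_one (norm_mul_le_one (norm_suppPow_le_one hH hz5)
    (norm_suppPow_le_one hσ hz2)) hYn) (norm_suppPow_le_one hσ hz2)

lemma suppPow_half_mul_suppPow_half (hσ : σ.PosSemidef) :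
    suppPow hσ (1 / 2) * suppPow hσ (1 / 2) = σ := by
  rw [suppPow_mul_suppPow, add_halves, suppPow_one]

lemma suppPow_half_conjTranspose (hσ : σ.PosSemidef) :
    (suppPow hσ (1 / 2)).conjTranspose = suppPow hσ (1 / 2) := by
  rw [suppPow_conjTranspose]
  simp

lemma suppPow_neg_half_conjTranspose (hσ : σ.PosSemidef) :
    (suppPow hσ (-(1 / 2))).conjTranspose = suppPow hσ (-(1 / 2)) := by
  rw [suppPow_conjTranspose]
  simp

/-- On the line `re z = 1` all factors but `G ^ a` can be arranged to be contractions around the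
map `X ↦ τ ^ (-1 / 2) Φ(σ ^ (1 / 2) X σ ^ (1 / 2)) τ ^ (-1 / 2)`, whose value at `1` is at most
`c` because `Φ(σ) ≤ c τ`. -/
lemma norm_interpFun_le_of_re_eq_one [DecidableEq κ] {c : ℝ} (hc : 0 ≤ c)
    (hστ : ((c : ℂ) • τ - krausMap K σ).PosSemidef) {z : ℂ} (hz : z.re = 1) :
    ‖interpFun K hH hσ hG hτ a z‖ ≤ c * (suppPow hG (a : ℂ)).trace.re := by
  obtain ⟨w, rfl⟩ : ∃ w, z = 1 + w := ⟨z - 1, by ring⟩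
  have hw : w.re = 0 := by simpa using hz
  have hw2 : (w / 2).re = 0 := by simp [hw]
  have hw3 : (-(w / 2)).re = 0 := by simp [hw]
  have hw4 : ((a : ℂ) * w).re = 0 := by simp [hw]
  have hw5 : ((a : ℂ) * (1 - (1 + w))).re = 0 := by simp [hw]
  have hσl : suppPow hσ ((1 + w) / 2) = suppPow hσ (1 / 2) * suppPow hσ (w / 2) := by
    rw [suppPow_mul_suppPow]; congr 1; ring
  have hσr : suppPow hσ ((1 + w) / 2) = suppPow hσ (w / 2) * suppPow hσ (1 / 2) := by
    rw [suppPow_mul_suppPow]; congr 1; ring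
  have hτl : suppPow hτ (-((1 + w) / 2)) = suppPow hτ (-(1 / 2)) * suppPow hτ (-(w / 2)) := by
    rw [suppPow_mul_suppPow]; congr 1; ring
  have hτr : suppPow hτ (-((1 + w) / 2)) = suppPow hτ (-(w / 2)) * suppPow hτ (-(1 / 2)) := by
    rw [suppPow_mul_suppPow]; congr 1; ring
  have hGl : suppPow hG (a * (1 + w)) = suppPow hG (a * w) * suppPow hG a := by
    rw [suppPow_mul_suppPow]; congr 1; ring
  set C := suppPow hσ (w / 2) * suppPow hH (a * (1 - (1 + w))) * suppPow hσ (w / 2) with hCdef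
  have hC : ‖C‖ ≤ 1 := norm_mul_le_one (norm_mul_le_one (norm_suppPow_le_one hσ hw2)
    (norm_suppPow_le_one hH hw5)) (norm_suppPow_le_one hσ hw2)
  set L : κ → Matrix m n ℂ := fun k => suppPow hτ (-(1 / 2)) * K k * suppPow hσ (1 / 2) with hLdef
  have hLC : ∀ X, suppPow hτ (-(1 / 2)) *
      krausMap K (suppPow hσ (1 / 2) * X * suppPow hσ (1 / 2)) *
        suppPow hτ (-(1 / 2)) = krausMap L X := by
    intro X
    have := mul_krausMap_mul K X (suppPow hσ (1 / 2)) (suppPow hτ (-(1 / 2)))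
    rwa [suppPow_half_conjTranspose, suppPow_neg_half_conjTranspose] at this
  have hL1 : ((c : ℂ) • (1 : Matrix m m ℂ) - krausMap L 1).PosSemidef := by
    rw [← hLC, Matrix.mul_one, suppPow_half_mul_suppPow_half]
    have h1 := hστ.mul_mul_conjTranspose_same (suppPow hτ (-(1 / 2)))
    have h2 : suppPow hτ (-(1 / 2)) * τ * suppPow hτ (-(1 / 2)) = suppPow hτ 0 := by
      conv_lhs => enter [1, 2]; rw [← suppPow_one hτ]
      rw [suppPow_mul_suppPow, suppPow_mul_suppPow]
      congr 1
      norm_num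
    rw [suppPow_neg_half_conjTranspose, Matrix.mul_sub, Matrix.sub_mul, Matrix.mul_smul,
      Matrix.smul_mul, h2] at h1
    have h3 := (posSemidef_one_sub_suppPow_zero hτ).smul
      (Complex.zero_le_real.2 hc)
    have h4 := h3.add h1
    convert h4 using 1
    rw [smul_sub]
    abel
  have hfin : interpFun K hH hσ hG hτ a (1 + w) = (suppPow hG a * (suppPow hτ (-(w / 2)) *
      krausMap L C * suppPow hτ (-(w / 2)) * suppPow hG (a * w))).trace := by
    unfold interpFun
    rw [trace_mul_krausMap_adjoint, ← hLC]
    nth_rw 1 [hσl]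
    rw [hσr]
    nth_rw 1 [hτl]
    rw [hτr, hGl, hCdef]
    simp only [Matrix.mul_assoc]
    rw [Matrix.trace_mul_comm]
    simp only [Matrix.mul_assoc]
    rw [Matrix.trace_mul_comm (suppPow hτ (-(1 / 2)))]
    simp only [Matrix.mul_assoc]
    rw [Matrix.trace_mul_comm (suppPow hτ (-(w / 2)))]
    simp only [Matrix.mul_assoc]
    rw [Matrix.trace_mul_comm (suppPow hG (a * w))]
    simp only [Matrix.mul_assoc]
  rw [hfin, mul_comm c]
  have htr : 0 ≤ (suppPow hG (a : ℂ)).trace.re :=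
    (Complex.le_def.1 (posSemidef_suppPow_ofReal hG a).trace_nonneg).1
  refine (norm_trace_mul_le (posSemidef_suppPow_ofReal hG a) _).trans ?_
  refine mul_le_mul_of_nonneg_left ?_ htr
  have hLn := norm_krausMap_le L hc hL1 hC
  calc _ ≤ ‖suppPow hτ (-(w / 2))‖ * ‖krausMap L C‖ * ‖suppPow hτ (-(w / 2))‖ *
        ‖suppPow hG (a * w)‖ := by
        refine (norm_mul_le _ _).trans ?_
        gcongr
        refine (norm_mul_le _ _).trans ?_
        gcongr
        exact norm_mul_le _ _
    _ ≤ 1 * c * 1 * 1 := by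
        gcongr
        · exact norm_suppPow_le_one hτ hw3
        · exact norm_suppPow_le_one hτ hw3
        · exact norm_suppPow_le_one hG hw4
    _ = c := by ring

/-- The product rule for `interpFun`; `L` stands for natural logarithms on supports. -/
lemma hasDerivAt_interpFun (z : ℂ) :
    HasDerivAt (interpFun K hH hσ hG hτ a)
      ((((1 / 2 : ℂ) • (suppPow hσ (z / 2) * specFun hσ (fun x => (Real.log x : ℂ))) *
            suppPow hH (a * (1 - z)) +
          suppPow hσ (z / 2) * (-(a : ℂ) •
            (suppPow hH (a * (1 - z)) * specFun hH (fun x => (Real.log x : ℂ))))) *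
          suppPow hσ (z / 2) +
        suppPow hσ (z / 2) * suppPow hH (a * (1 - z)) *
          ((1 / 2 : ℂ) • (suppPow hσ (z / 2) * specFun hσ (fun x => (Real.log x : ℂ))))) *
        krausMap (fun k => (K k).conjTranspose)
          (suppPow hτ (-(z / 2)) * suppPow hG (a * z) * suppPow hτ (-(z / 2))) +
      suppPow hσ (z / 2) * suppPow hH (a * (1 - z)) * suppPow hσ (z / 2) *
        krausMap (fun k => (K k).conjTranspose)
          (((-(1 / 2) : ℂ) • (suppPow hτ (-(z / 2)) * specFun hτ (fun x => (Real.log x : ℂ))) *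
              suppPow hG (a * z) +
            suppPow hτ (-(z / 2)) * ((a : ℂ) •
              (suppPow hG (a * z) * specFun hG (fun x => (Real.log x : ℂ))))) *
            suppPow hτ (-(z / 2)) +
          suppPow hτ (-(z / 2)) * suppPow hG (a * z) *
            ((-(1 / 2) : ℂ) • (suppPow hτ (-(z / 2)) *
              specFun hτ (fun x => (Real.log x : ℂ)))))).trace z := by
  have dσ := (hasDerivAt_suppPow hσ (z / 2)).scomp z ((hasDerivAt_id z).div_const 2)
  have dτ := (hasDerivAt_suppPow hτ (-(z / 2))).scomp z ((hasDerivAt_id z).div_const 2).neg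
  have dH := (hasDerivAt_suppPow hH (a * (1 - z))).scomp z
    (((hasDerivAt_id z).const_sub 1).const_mul (a : ℂ))
  have dG := (hasDerivAt_suppPow hG (a * z)).scomp z ((hasDerivAt_id z).const_mul (a : ℂ))
  simp only [mul_one, mul_neg] at dH dG
  have d2 := (krausMap fun k =>
    (K k).conjTranspose).toContinuousLinearMap.hasFDerivAt.comp_hasDerivAt z ((dτ.mul dG).mul dτ)
  have d3 := ((Matrix.traceLinearMap n ℂ ℂ).toContinuousLinearMap.hasFDerivAt).comp_hasDerivAt
    z (((dσ.mul dH).mul dσ).mul d2)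
  exact d3

lemma exists_norm_suppPow_le {A : Matrix n n ℂ} (hA : A.PosSemidef) (R : ℝ) :
    ∃ M : ℝ, 0 ≤ M ∧ ∀ z : ℂ, |z.re| ≤ R → ‖suppPow hA z‖ ≤ M := by
  refine ⟨_, (Real.exp_pos (R * ∑ i, |Real.log (hA.1.eigenvalues i)|)).le, fun z hz => ?_⟩
  refine (norm_suppPow_le hA z).trans (Real.exp_le_exp.2 ?_)
  exact mul_le_mul_of_nonneg_right hz (Finset.sum_nonneg fun _ _ => abs_nonneg _)

lemma bddAbove_norm_interpFun :
    BddAbove ((norm ∘ interpFun K hH hσ hG hτ a) ''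
      Complex.HadamardThreeLines.verticalClosedStrip 0 1) := by
  obtain ⟨Mσ, hMσ, bσ⟩ := exists_norm_suppPow_le hσ 1
  obtain ⟨Mτ, hMτ, bτ⟩ := exists_norm_suppPow_le hτ 1
  obtain ⟨MH, hMH, bH⟩ := exists_norm_suppPow_le hH |a|
  obtain ⟨MG, hMG, bG⟩ := exists_norm_suppPow_le hG |a|
  set Ψ := (krausMap fun k => (K k).conjTranspose).toContinuousLinearMap with hΨ
  refine ⟨(1 : Matrix n n ℂ).trace.re * (Mσ * MH * Mσ * (‖Ψ‖ * (Mτ * MG * Mτ))), ?_⟩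
  rintro _ ⟨z, hz, rfl⟩
  simp only [Complex.HadamardThreeLines.verticalClosedStrip, Set.mem_preimage, Set.mem_Icc] at hz
  have h1 : |(z / 2).re| ≤ 1 := by
    rw [abs_le]; constructor <;> simp <;> linarith
  have h2 : |(-(z / 2)).re| ≤ 1 := by rwa [Complex.neg_re, abs_neg]
  have h3 : |((a : ℂ) * (1 - z)).re| ≤ |a| := by
    rw [Complex.re_ofReal_mul, abs_mul]
    refine mul_le_of_le_one_right (abs_nonneg _) ?_
    rw [abs_le]; constructor <;> simp <;> linarith
  have h4 : |((a : ℂ) * z).re| ≤ |a| := by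
    rw [Complex.re_ofReal_mul, abs_mul]
    refine mul_le_of_le_one_right (abs_nonneg _) ?_
    rw [abs_le]; constructor <;> linarith
  have htr := norm_trace_mul_le (Matrix.PosSemidef.one (n := n) (R := ℂ))
    (suppPow hσ (z / 2) * suppPow hH (a * (1 - z)) * suppPow hσ (z / 2) *
      Ψ (suppPow hτ (-(z / 2)) * suppPow hG (a * z) * suppPow hτ (-(z / 2))))
  rw [Matrix.one_mul] at htr
  refine htr.trans (mul_le_mul_of_nonneg_left ?_
    (Complex.le_def.1 (Matrix.PosSemidef.one (n := n) (R := ℂ)).trace_nonneg).1)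
  refine (norm_mul_le _ _).trans ?_
  have b1 : ‖suppPow hσ (z / 2) * suppPow hH (a * (1 - z)) * suppPow hσ (z / 2)‖ ≤
      Mσ * MH * Mσ := by
    refine (norm_mul_le _ _).trans ?_
    gcongr
    · refine (norm_mul_le _ _).trans ?_
      gcongr
      · exact bσ _ h1
      · exact bH _ h3
    · exact bσ _ h1
  have b2 : ‖suppPow hτ (-(z / 2)) * suppPow hG (a * z) * suppPow hτ (-(z / 2))‖ ≤
      Mτ * MG * Mτ := by
    refine (norm_mul_le _ _).trans ?_
    gcongr
    · refine (norm_mul_le _ _).trans ?_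
      gcongr
      · exact bτ _ h2
      · exact bG _ h4
    · exact bτ _ h2
  gcongr
  exact (Ψ.le_opNorm _).trans (mul_le_mul_of_nonneg_left b2 (norm_nonneg _))

/-- Hadamard's three lines theorem for `interpFun`. -/
lemma norm_interpFun_le [DecidableEq κ] (hK : ∑ k, (K k).conjTranspose * K k = 1)
    {c : ℝ} (hc : 0 ≤ c)
    (hστ : ((c : ℂ) • τ - krausMap K σ).PosSemidef) {x : ℝ} (h0 : 0 ≤ x) (h1 : x ≤ 1) :
    ‖interpFun K hH hσ hG hτ a x‖ ≤
      (suppPow hH (a : ℂ)).trace.re ^ (1 - x) * (c * (suppPow hG (a : ℂ)).trace.re) ^ x := by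
  have hd : Differentiable ℂ (interpFun K hH hσ hG hτ a) := fun z =>
    (hasDerivAt_interpFun K hH hσ hG hτ a z).differentiableAt
  have := Complex.HadamardThreeLines.norm_le_interp_of_mem_verticalClosedStrip₀₁'
    (interpFun K hH hσ hG hτ a) (z := (x : ℂ)) (a := (suppPow hH (a : ℂ)).trace.re)
    (b := c * (suppPow hG (a : ℂ)).trace.re)
    (by simpa [Complex.HadamardThreeLines.verticalClosedStrip] using ⟨h0, h1⟩)
    hd.diffContOnCl (bddAbove_norm_interpFun K hH hσ hG hτ a)
    (fun z hz => norm_interpFun_le_of_re_eq_zero K hH hσ hG hτ a hK hz)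
    (fun z hz => norm_interpFun_le_of_re_eq_one K hH hσ hG hτ a hc hστ hz)
  simpa using this

end ThreeLines

/-! ### The data-processed triangle inequality -/

section DataProcessing

variable {n m κ : Type*} [Fintype n] [DecidableEq n] [Fintype m] [DecidableEq m]
  [Fintype κ] {ρ σ : Matrix n n ℂ} {τ : Matrix m m ℂ} {K : κ → Matrix m n ℂ}

lemma trace_krausMap (hK : ∑ k, (K k).conjTranspose * K k = 1) (X : Matrix n n ℂ) :
    (krausMap K X).trace = X.trace := by
  have h := trace_mul_krausMap_adjoint K X 1
  rw [Matrix.mul_one] at h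
  rw [← h, krausMap_apply]
  simp [hK]

omit [DecidableEq m] in
/-- If `N Φ(X) Nᴴ ≤ 0`, then each `N K X` vanishes: with `S = X ^ (1 / 2)` the former is the sum of
the positive matrices `(N K S) (N K S)ᴴ`. -/
lemma mul_kraus_mul_eq_zero {X : Matrix n n ℂ} (hX : X.PosSemidef) (N : Matrix m m ℂ)
    (h : (-(N * krausMap K X * N.conjTranspose)).PosSemidef) (k : κ) : N * K k * X = 0 := by
  set S := suppPow hX (1 / 2) with hS
  have hSS : S * S.conjTranspose = X := by
    rw [hS, suppPow_half_conjTranspose, suppPow_half_mul_suppPow_half]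
  have h1 : N * krausMap K X * N.conjTranspose =
      ∑ k, (N * K k * S) * (N * K k * S).conjTranspose := by
    simp only [krausMap_apply, Matrix.mul_sum, Matrix.sum_mul, Matrix.conjTranspose_mul]
    refine Finset.sum_congr rfl fun k _ => ?_
    rw [← hSS]
    simp only [Matrix.mul_assoc]
  have h2 : ∑ k, ((N * K k * S) * (N * K k * S).conjTranspose).trace ≤ 0 := by
    rw [← Matrix.trace_sum, ← h1]
    have := h.trace_nonneg
    rwa [Matrix.trace_neg, Left.nonneg_neg_iff] at this
  have h3 : ∀ k ∈ Finset.univ, 0 ≤ ((N * K k * S) * (N * K k * S).conjTranspose).trace :=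
    fun k _ => (Matrix.posSemidef_self_mul_conjTranspose _).trace_nonneg
  have h4 := (Finset.sum_eq_zero_iff_of_nonneg h3).1 (le_antisymm h2 (Finset.sum_nonneg h3)) k
    (Finset.mem_univ k)
  rw [Matrix.trace_mul_conjTranspose_self_eq_zero_iff] at h4
  rw [← suppPow_half_mul_suppPow_half hX, ← Matrix.mul_assoc, ← hS, h4, Matrix.zero_mul]

lemma one_sub_suppPow_zero_mul_self {A : Matrix n n ℂ} (hA : A.PosSemidef) :
    (1 - suppPow hA 0) * A = 0 := by
  rw [Matrix.sub_mul, Matrix.one_mul, suppPow_zero_mul_self, sub_self]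

/-- `Φ` maps the support of `ρ` into that of `τ` if `ρ` is supported in `σ` and `Φ(σ) ≤ c τ`. -/
lemma suppPow_zero_mul_krausMap (hσ : σ.PosSemidef) (hτ : τ.PosSemidef) {c : ℂ}
    (hστ : (c • τ - krausMap K σ).PosSemidef) (h : suppPow hσ 0 * ρ = ρ) :
    suppPow hτ 0 * krausMap K ρ = krausMap K ρ := by
  have h1 := hστ.mul_mul_conjTranspose_same (1 - suppPow hτ 0)
  rw [Matrix.mul_sub, Matrix.mul_smul, one_sub_suppPow_zero_mul_self, smul_zero, zero_sub,
    Matrix.neg_mul] at h1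
  have h2 : (1 - suppPow hτ 0) * krausMap K ρ = 0 := by
    rw [krausMap_apply, Matrix.mul_sum]
    refine Finset.sum_eq_zero fun k _ => ?_
    rw [← h, ← self_mul_suppPow_neg_one hσ]
    have := mul_kraus_mul_eq_zero hσ _ h1 k
    simp only [← Matrix.mul_assoc, this, Matrix.zero_mul]
  rw [Matrix.sub_mul, Matrix.one_mul, sub_eq_zero] at h2
  exact h2.symm

/-- The adjoint of `Φ` maps the support projection of `Φ(ρ)` to an operator that acts as the
identity on the support of `ρ`. -/
lemma krausMap_adjoint_suppPow_zero_mul (hK : ∑ k, (K k).conjTranspose * K k = 1)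
    (hρ : ρ.PosSemidef) (hω : (krausMap K ρ).PosSemidef) :
    krausMap (fun k => (K k).conjTranspose) (suppPow hω 0) * ρ = ρ := by
  have h1 : ∀ k, suppPow hω 0 * (K k * ρ) = K k * ρ := by
    intro k
    have := mul_kraus_mul_eq_zero (K := K) hρ (1 - suppPow hω 0)
      (by rw [one_sub_suppPow_zero_mul_self]; simpa using Matrix.PosSemidef.zero) k
    rw [Matrix.sub_mul, Matrix.one_mul, Matrix.sub_mul, sub_eq_zero] at this
    rw [← Matrix.mul_assoc, this]
  rw [krausMap_apply, Matrix.sum_mul]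
  simp only [Matrix.conjTranspose_conjTranspose, Matrix.mul_assoc, h1]
  simp only [← Matrix.mul_assoc, ← Matrix.sum_mul, hK, Matrix.one_mul]

lemma mul_krausMap_adjoint_suppPow_zero (hK : ∑ k, (K k).conjTranspose * K k = 1)
    (hρ : ρ.PosSemidef) (hω : (krausMap K ρ).PosSemidef) :
    ρ * krausMap (fun k => (K k).conjTranspose) (suppPow hω 0) = ρ := by
  have h := congrArg Matrix.conjTranspose (krausMap_adjoint_suppPow_zero_mul hK hρ hω)
  have h0 : (suppPow hω 0).PosSemidef := by simpa using posSemidef_suppPow_ofReal hω 0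
  rwa [Matrix.conjTranspose_mul, hρ.1.eq, (posSemidef_krausMap _ h0).1.eq] at h

lemma mul_suppPow_zero_of_suppPow_zero_mul {A B : Matrix n n ℂ} (hA : A.PosSemidef)
    (hB : B.PosSemidef) (h : suppPow hB 0 * A = A) : A * suppPow hB 0 = A := by
  have := congrArg Matrix.conjTranspose h
  rwa [Matrix.conjTranspose_mul, suppPow_zero_conjTranspose, hA.1.eq] at this

lemma log_two_mul_trace_mul_mlog_sub {A B : Matrix n n ℂ} (hA : A.PosSemidef)
    (hB : B.PosSemidef) : (Real.log 2 : ℂ) * (A * (mlog A - mlog B)).trace =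
      (A * specFun hA (fun x => (Real.log x : ℂ))).trace -
        (A * specFun hB (fun x => (Real.log x : ℂ))).trace := by
  rw [specFun_log_eq hA, specFun_log_eq hB, Matrix.mul_sub, Matrix.trace_sub, Matrix.mul_smul,
    Matrix.mul_smul, Matrix.trace_smul, Matrix.trace_smul, smul_eq_mul, smul_eq_mul, mul_sub]

/-- For `a = 1`, `H = ρ` and `G = Φ(ρ)` the derivative of `interpFun` at zero is the difference of
the relative entropies, `log 2 * (D(Φ(ρ)‖τ) - D(ρ‖σ))`. -/
lemma hasDerivAt_interpFun_zero (hK : ∑ k, (K k).conjTranspose * K k = 1)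
    (hρ : ρ.PosSemidef) (hσ : σ.PosSemidef) (hω : (krausMap K ρ).PosSemidef) (hτ : τ.PosSemidef)
    (hρσ : suppPow hσ 0 * ρ = ρ) (hωτ : suppPow hτ 0 * krausMap K ρ = krausMap K ρ) :
    HasDerivAt (interpFun K hρ hσ hω hτ 1)
      ((Real.log 2 : ℂ) * ((krausMap K ρ * (mlog (krausMap K ρ) - mlog τ)).trace -
        (ρ * (mlog ρ - mlog σ)).trace)) 0 := by
  have hρσ' := mul_suppPow_zero_of_suppPow_zero_mul hρ hσ hρσ
  have hωτ' := mul_suppPow_zero_of_suppPow_zero_mul hω hτ hωτ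
  have hQR : suppPow hτ 0 * suppPow hω 0 = suppPow hω 0 := by
    rw [← self_mul_suppPow_neg_one hω, ← Matrix.mul_assoc, hωτ]
  have hRQ : suppPow hω 0 * suppPow hτ 0 = suppPow hω 0 := by
    rw [← suppPow_neg_one_mul_self hω, Matrix.mul_assoc, hωτ']
  have d := hasDerivAt_interpFun K hρ hσ hω hτ 1 0
  simp only [zero_div, neg_zero, sub_zero, mul_one, mul_zero, Complex.ofReal_one, suppPow_one,
    suppPow_zero_mul_log, hQR, hRQ, hρσ, hρσ'] at d
  convert d using 1
  rw [mul_sub, log_two_mul_trace_mul_mlog_sub hω hτ, log_two_mul_trace_mul_mlog_sub hρ hσ]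
  have e := log_mul_self_comm hρ
  set Lρ := specFun hρ (fun x => (Real.log x : ℂ))
  set Lσ := specFun hσ (fun x => (Real.log x : ℂ))
  set Lτ := specFun hτ (fun x => (Real.log x : ℂ))
  set Lω := specFun hω (fun x => (Real.log x : ℂ))
  set P := suppPow hσ 0
  set Q := suppPow hτ 0
  set R := suppPow hω 0 with hR
  set Ψ := krausMap (fun k => (K k).conjTranspose) with hΨ
  have hΨl : Ψ R * ρ = ρ := krausMap_adjoint_suppPow_zero_mul hK hρ hω
  have hΨr : ρ * Ψ R = ρ := mul_krausMap_adjoint_suppPow_zero hK hρ hω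
  -- The part where the powers of `ρ` and `σ` are differentiated.
  have t1 : (((1 / 2 : ℂ) • Lσ * ρ + P * (-1 : ℂ) • (ρ * Lρ)) * P + ρ * ((1 / 2 : ℂ) • Lσ)) * Ψ R =
      (1 / 2 : ℂ) • (Lσ * ρ) - Lρ * ρ + (1 / 2 : ℂ) • (ρ * Lσ * Ψ R) := by
    rw [← e]
    simp only [Matrix.smul_mul, Matrix.mul_smul, Matrix.add_mul, neg_smul, one_smul,
      Matrix.mul_neg, Matrix.neg_mul, Matrix.mul_assoc, hρσ', hΨr]
    rw [e, ← Matrix.mul_assoc P, hρσ, ← e, sub_eq_add_neg]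
  have t1' : (ρ * Lσ * Ψ R).trace = (ρ * Lσ).trace := by
    rw [Matrix.mul_assoc, Matrix.trace_mul_comm, Matrix.mul_assoc, hΨl, Matrix.trace_mul_comm]
  -- The part where the powers of `Φ(ρ)` and `τ` are differentiated.
  have t2 : (krausMap K ρ * (((-(1 / 2) : ℂ) • Lτ * R + Q * (1 : ℂ) • Lω) * Q +
      R * ((-(1 / 2) : ℂ) • Lτ))).trace =
      (krausMap K ρ * Lω).trace - (krausMap K ρ * Lτ).trace := by
    have a1 : (krausMap K ρ * (Lτ * R * Q)).trace = (krausMap K ρ * Lτ).trace := by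
      rw [Matrix.mul_assoc, hRQ, ← Matrix.mul_assoc, Matrix.trace_mul_comm, ← Matrix.mul_assoc,
        suppPow_zero_mul_self]
    have a2 : (krausMap K ρ * (Q * Lω * Q)).trace = (krausMap K ρ * Lω).trace := by
      rw [Matrix.mul_assoc, ← Matrix.mul_assoc, hωτ', ← Matrix.mul_assoc, Matrix.trace_mul_comm,
        ← Matrix.mul_assoc, hωτ]
    have a3 : (krausMap K ρ * (R * Lτ)).trace = (krausMap K ρ * Lτ).trace := by
      rw [← Matrix.mul_assoc, self_mul_suppPow_zero]
    simp only [Matrix.smul_mul, Matrix.mul_smul, Matrix.add_mul, Matrix.mul_add, one_smul,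
      Matrix.trace_add, Matrix.trace_smul, a1, a2, a3, smul_eq_mul]
    ring
  rw [t1, Matrix.trace_add, trace_mul_krausMap_adjoint K ρ, t2, Matrix.trace_add, Matrix.trace_sub,
    Matrix.trace_smul, Matrix.trace_smul, t1', Matrix.trace_mul_comm Lσ, Matrix.trace_mul_comm Lρ,
    smul_eq_mul]
  ring

lemma interpFun_zero (hK : ∑ k, (K k).conjTranspose * K k = 1)
    (hρ : ρ.PosSemidef) (hσ : σ.PosSemidef) (hω : (krausMap K ρ).PosSemidef) (hτ : τ.PosSemidef)
    (hρσ : suppPow hσ 0 * ρ = ρ) (hωτ : suppPow hτ 0 * krausMap K ρ = krausMap K ρ) :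
    interpFun K hρ hσ hω hτ 1 0 = ρ.trace := by
  have hQR : suppPow hτ 0 * suppPow hω 0 = suppPow hω 0 := by
    rw [← self_mul_suppPow_neg_one hω, ← Matrix.mul_assoc, hωτ]
  have hRQ : suppPow hω 0 * suppPow hτ 0 = suppPow hω 0 := by
    rw [← suppPow_neg_one_mul_self hω, Matrix.mul_assoc,
      mul_suppPow_zero_of_suppPow_zero_mul hω hτ hωτ]
  unfold interpFun
  simp only [zero_div, neg_zero, sub_zero, mul_one, mul_zero, Complex.ofReal_one, suppPow_one,
    hQR, hRQ, hρσ, mul_suppPow_zero_of_suppPow_zero_mul hρ hσ hρσ,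
    mul_krausMap_adjoint_suppPow_zero hK hρ hω]

/-- At `x = 1 - 1 / α`, with `H = σ ^ s ρ σ ^ s` and `G = τ ^ s Φ(ρ) τ ^ s` for
`s = (1 - α) / (2 α) = -x / 2`, the interpolating function is `tr (G ^ α)`. -/
lemma interpFun_sandwiched {α : ℝ} (hα : 1 < α) {s : ℝ} (hs : s = (1 - α) / (2 * α))
    (hρ : ρ.PosSemidef) (hσ : σ.PosSemidef) (hτ : τ.PosSemidef)
    (hH : (suppPow hσ s * ρ * suppPow hσ s).PosSemidef)
    (hG : (suppPow hτ s * krausMap K ρ * suppPow hτ s).PosSemidef)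
    (hρσ : suppPow hσ 0 * ρ = ρ) :
    interpFun K hH hσ hG hτ α ((1 - 1 / α : ℝ) : ℂ) = (suppPow hG (α : ℂ)).trace := by
  have hα0 : α ≠ 0 := by linarith
  have hρσ' := mul_suppPow_zero_of_suppPow_zero_mul hρ hσ hρσ
  have e1 : (((1 - 1 / α : ℝ) : ℂ) / 2) = ((-s : ℝ) : ℂ) := by
    rw [hs]; push_cast; field_simp; ring
  have e2 : (α : ℂ) * (1 - ((1 - 1 / α : ℝ) : ℂ)) = 1 := by
    have : (α : ℂ) ≠ 0 := by exact_mod_cast hα0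
    push_cast; field_simp; ring
  have e3 : (α : ℂ) * ((1 - 1 / α : ℝ) : ℂ) = ((α - 1 : ℝ) : ℂ) := by
    have : (α : ℂ) ≠ 0 := by exact_mod_cast hα0
    push_cast; field_simp
  have e4 : -((-s : ℝ) : ℂ) = (s : ℂ) := by push_cast; ring
  unfold interpFun
  rw [e1, e2, e3, e4, suppPow_one]
  have h1 : suppPow hσ ((-s : ℝ) : ℂ) * (suppPow hσ s * ρ * suppPow hσ s) *
      suppPow hσ ((-s : ℝ) : ℂ) = ρ := by
    have a1 : suppPow hσ ((-s : ℝ) : ℂ) * suppPow hσ s = suppPow hσ 0 := by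
      rw [suppPow_mul_suppPow]; simp
    have a2 : suppPow hσ s * suppPow hσ ((-s : ℝ) : ℂ) = suppPow hσ 0 := by
      rw [suppPow_mul_suppPow]; simp
    rw [← Matrix.mul_assoc, ← Matrix.mul_assoc, a1, hρσ, Matrix.mul_assoc, a2, hρσ']
  rw [h1, trace_mul_krausMap_adjoint]
  have h2 : (krausMap K ρ * (suppPow hτ s * suppPow hG ((α - 1 : ℝ) : ℂ) * suppPow hτ s)).trace =
      ((suppPow hτ s * krausMap K ρ * suppPow hτ s) * suppPow hG ((α - 1 : ℝ) : ℂ)).trace := by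
    simp only [← Matrix.mul_assoc]
    rw [Matrix.trace_mul_comm]
    simp only [← Matrix.mul_assoc]
  rw [h2]
  conv_lhs => enter [1, 1]; rw [← suppPow_one hG]
  rw [suppPow_mul_suppPow]
  congr 2
  push_cast
  ring

variable [DecidableEq κ]

/-- Data processing for the relative entropy combined with a change of the second argument. The
function `x ↦ 2 ^ (t x) - re (interpFun x)` is nonnegative on `[0, 1]` and vanishes at `0`, so its
derivative there is nonnegative. -/
lemma relEntropy_krausMap_le (hK : ∑ k, (K k).conjTranspose * K k = 1)
    (hρ : ρ.PosSemidef) (hρ1 : ρ.trace = 1) (hσ : σ.PosSemidef) (hτ : τ.PosSemidef) {t : ℝ}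
    (hστ : ((((2 : ℝ) ^ t : ℝ) : ℂ) • τ - krausMap K σ).PosSemidef) :
    relEntropy (krausMap K ρ) τ ≤ t + relEntropy ρ σ := by
  have hω := posSemidef_krausMap K hρ
  unfold relEntropy
  by_cases h : supp ρ ≤ supp σ
  swap
  · rw [if_neg h, EReal.coe_add_top]
    exact le_top
  have hρσ := (supp_le_supp_iff hσ).1 h
  have hωτ := suppPow_zero_mul_krausMap hσ hτ hστ hρσ
  rw [if_pos h, if_pos ((supp_le_supp_iff hτ).2 hωτ), ← EReal.coe_add, EReal.coe_le_coe_iff]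
  have hc : (0 : ℝ) < 2 ^ t := by positivity
  set Dρ := (ρ * (mlog ρ - mlog σ)).trace with hDρ
  set Dω := (krausMap K ρ * (mlog (krausMap K ρ) - mlog τ)).trace with hDω
  have d := hasDerivAt_interpFun_zero hK hρ hσ hω hτ hρσ hωτ
  rw [← hDρ, ← hDω] at d
  have d1 : HasDerivAt (fun x : ℝ => ((2 : ℝ) ^ t) ^ x - (interpFun K hρ hσ hω hτ 1 x).re)
      (t * Real.log 2 - Real.log 2 * (Dω.re - Dρ.re)) 0 := by
    have d2 := (Real.hasStrictDerivAt_const_rpow hc 0).hasDerivAt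
    have d3 := HasDerivAt.real_of_complex (z := 0) (by rwa [Complex.ofReal_zero])
    have d4 := d2.sub d3
    rw [Real.rpow_zero, one_mul, Real.log_rpow two_pos, Complex.re_ofReal_mul,
      Complex.sub_re] at d4
    exact d4
  have h0 : interpFun K hρ hσ hω hτ 1 0 = 1 := by
    rw [interpFun_zero hK hρ hσ hω hτ hρσ hωτ, hρ1]
  have hnn : 0 ≤ t * Real.log 2 - Real.log 2 * (Dω.re - Dρ.re) := by
    refine ge_of_tendsto d1.tendsto_slope_zero_right ?_
    filter_upwards [Ioo_mem_nhdsGT (zero_lt_one (α := ℝ))] with x hx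
    have hb := norm_interpFun_le K hρ hσ hω hτ 1 hK hc.le hστ hx.1.le hx.2.le
    rw [Complex.ofReal_one, suppPow_one, suppPow_one, trace_krausMap hK, hρ1] at hb
    simp only [Complex.one_re, Real.one_rpow, one_mul, mul_one] at hb
    have hb2 := (Complex.re_le_norm _).trans hb
    simp only [zero_add, Real.rpow_zero, Complex.ofReal_zero, h0, Complex.one_re, sub_self,
      sub_zero, smul_eq_mul]
    exact mul_nonneg (inv_nonneg.2 hx.1.le) (sub_nonneg.2 hb2)
  have hl : 0 < Real.log 2 := Real.log_pos one_lt_two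
  nlinarith

/-- Data processing for the sandwiched Rényi divergence combined with a change of the second
argument. -/
lemma sandwichedRenyi_krausMap_le (hK : ∑ k, (K k).conjTranspose * K k = 1) {α : ℝ} (hα : 1 < α)
    (hρ : ρ.PosSemidef) (hρ1 : ρ.trace = 1) (hσ : σ.PosSemidef) (hτ : τ.PosSemidef) {t : ℝ}
    (hστ : ((((2 : ℝ) ^ t : ℝ) : ℂ) • τ - krausMap K σ).PosSemidef) :
    sandwichedRenyi α (krausMap K ρ) τ ≤ t + sandwichedRenyi α ρ σ := by
  have hω := posSemidef_krausMap K hρ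
  unfold sandwichedRenyi
  by_cases h : supp ρ ≤ supp σ
  swap
  · rw [if_neg h, EReal.coe_add_top]
    exact le_top
  have hρσ := (supp_le_supp_iff hσ).1 h
  have hωτ := suppPow_zero_mul_krausMap hσ hτ hστ hρσ
  rw [if_pos h, if_pos ((supp_le_supp_iff hτ).2 hωτ), ← EReal.coe_add, EReal.coe_le_coe_iff]
  have hc : (0 : ℝ) < 2 ^ t := by positivity
  have hα0 : α ≠ 0 := by linarith
  obtain ⟨s, hs⟩ : ∃ s, s = (1 - α) / (2 * α) := ⟨_, rfl⟩
  have hs0 : s ≠ 0 := by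
    rw [hs]
    exact div_ne_zero (by linarith) (by linarith)
  rw [← hs, ← suppPow_ofReal hσ hs0, ← suppPow_ofReal hτ hs0]
  have hH : (suppPow hσ s * ρ * suppPow hσ s).PosSemidef := by
    have := hρ.mul_mul_conjTranspose_same (suppPow hσ s)
    rwa [(posSemidef_suppPow_ofReal hσ s).1.eq] at this
  have hG : (suppPow hτ s * krausMap K ρ * suppPow hτ s).PosSemidef := by
    have := hω.mul_mul_conjTranspose_same (suppPow hτ s)
    rwa [(posSemidef_suppPow_ofReal hτ s).1.eq] at this
  rw [← suppPow_ofReal hH hα0, ← suppPow_ofReal hG hα0]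
  have hb := norm_interpFun_le K hH hσ hG hτ α hK hc.le hστ (x := 1 - 1 / α)
    (by rw [sub_nonneg, div_le_one (by linarith)]; exact hα.le)
    (by have : 0 < 1 / α := by positivity
        linarith)
  rw [interpFun_sandwiched hα hs hρ hσ hτ hH hG hρσ] at hb
  replace hb := (Complex.re_le_norm _).trans hb
  set g := (suppPow hG (α : ℂ)).trace.re with hg
  set h' := (suppPow hH (α : ℂ)).trace.re with hh'
  -- `tr (G ^ α) = 0` would force `G = 0` and then `Φ(ρ) = 0`, which has trace one.
  have hGpsd := posSemidef_suppPow_ofReal hG α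
  have hg0 : 0 < g := by
    refine lt_of_le_of_ne (Complex.le_def.1 hGpsd.trace_nonneg).1 fun hne => ?_
    have z1 : (suppPow hG (α : ℂ)).trace = 0 :=
      Complex.ext hne.symm (Complex.le_def.1 hGpsd.trace_nonneg).2.symm
    rw [hGpsd.trace_eq_zero_iff] at z1
    have z2 : suppPow hτ s * krausMap K ρ * suppPow hτ s = 0 := by
      rw [← suppPow_one hG]
      have := suppPow_mul_suppPow hG (α : ℂ) (1 - α)
      rw [z1, Matrix.zero_mul, add_sub_cancel] at this
      exact this.symm
    have z3 : suppPow hτ ((-s : ℝ) : ℂ) * (suppPow hτ s * krausMap K ρ * suppPow hτ s) *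
        suppPow hτ ((-s : ℝ) : ℂ) = krausMap K ρ := by
      have a1 : suppPow hτ ((-s : ℝ) : ℂ) * suppPow hτ s = suppPow hτ 0 := by
        rw [suppPow_mul_suppPow]; simp
      have a2 : suppPow hτ s * suppPow hτ ((-s : ℝ) : ℂ) = suppPow hτ 0 := by
        rw [suppPow_mul_suppPow]; simp
      rw [← Matrix.mul_assoc, ← Matrix.mul_assoc, a1, hωτ, Matrix.mul_assoc, a2,
        mul_suppPow_zero_of_suppPow_zero_mul hω hτ hωτ]
    rw [z2, Matrix.mul_zero, Matrix.zero_mul] at z3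
    have z4 := trace_krausMap hK ρ
    rw [← z3, hρ1, Matrix.trace_zero] at z4
    exact zero_ne_one z4
  have hh0 : 0 < h' := by
    refine lt_of_le_of_ne
      (Complex.le_def.1 (posSemidef_suppPow_ofReal hH α).trace_nonneg).1 fun hne => ?_
    rw [← hne, sub_sub_cancel, Real.zero_rpow (one_div_ne_zero hα0), zero_mul] at hb
    exact absurd hb (not_le.2 hg0)
  have hlog := Real.log_le_log hg0 hb
  rw [sub_sub_cancel, Real.log_mul (by positivity) (by positivity), Real.log_rpow hh0,
    Real.log_rpow (by positivity), Real.log_mul hc.ne' hg0.ne', Real.log_rpow two_pos] at hlog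
  have hα1 : 0 < α - 1 := by linarith
  have hl : 0 < Real.log 2 := Real.log_pos one_lt_two
  have hlog2 : Real.log g ≤ Real.log h' + (α - 1) * (t * Real.log 2) := by
    have h3 := mul_le_mul_of_nonneg_left hlog (by linarith : (0 : ℝ) ≤ α)
    have h4 : α * (1 / α * Real.log h' + (1 - 1 / α) * (t * Real.log 2 + Real.log g)) =
        Real.log h' + (α - 1) * (t * Real.log 2 + Real.log g) := by
      field_simp
    rw [h4] at h3
    linarith
  unfold Real.logb
  rw [div_mul_div_comm, div_mul_div_comm, one_mul, one_mul, div_le_iff₀ (by positivity), add_mul,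
    div_mul_cancel₀ _ (by positivity)]
  linarith

omit [DecidableEq n] [DecidableEq m] [DecidableEq κ] in
/-- Data processing for the max-relative entropy combined with a change of the second argument. -/
lemma Dmax_krausMap_le {t : ℝ} (ht : 0 ≤ t)
    (hστ : ((((2 : ℝ) ^ t : ℝ) : ℂ) • τ - krausMap K σ).PosSemidef) :
    Dmax (krausMap K ρ) τ ≤ t + Dmax ρ σ := by
  rw [add_comm, ← EReal.sub_le_iff_le_add (by simp) (by simp)]
  unfold Dmax
  refine le_iInf₂ fun u hu => ?_
  rw [EReal.sub_le_iff_le_add (by simp) (by simp)]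
  rw [← EReal.coe_add]
  refine iInf₂_le (u + t) ⟨add_nonneg hu.1 ht, ?_⟩
  have h1 := posSemidef_krausMap K hu.2
  have hc : (0 : ℝ) ≤ 2 ^ u := by positivity
  have h2 := (hστ.smul (Complex.zero_le_real.2 hc)).add h1
  rw [map_sub, map_smul, smul_sub, smul_smul, ← Complex.ofReal_mul, ← Real.rpow_add two_pos,
    sub_add_sub_cancel] at h2
  exact h2

/-- The data-processed triangle inequality: `D_α(Φ(ρ)‖τ) ≤ t + D_α(ρ‖σ)` if `Φ(σ) ≤ 2 ^ t τ`. -/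
lemma Dalpha_krausMap_le (hK : ∑ k, (K k).conjTranspose * K k = 1) {α : ℝ≥0∞} (hα : 1 ≤ α)
    (hρ : IsState ρ) (hσ : σ.PosSemidef) (hτ : τ.PosSemidef) {t : ℝ} (ht : 0 ≤ t)
    (hστ : ((((2 : ℝ) ^ t : ℝ) : ℂ) • τ - krausMap K σ).PosSemidef) :
    Dalpha α (krausMap K ρ) τ ≤ t + Dalpha α ρ σ := by
  unfold Dalpha
  split_ifs with h1 h2
  · exact relEntropy_krausMap_le hK hρ.1 hρ.2 hσ hτ hστ
  · exact Dmax_krausMap_le ht hστ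
  · refine sandwichedRenyi_krausMap_le hK ?_ hρ.1 hρ.2 hσ hτ hστ
    rw [← ENNReal.toReal_one, ENNReal.toReal_lt_toReal ENNReal.one_ne_top h2]
    exact lt_of_le_of_ne hα (Ne.symm h1)

end DataProcessing

/-! ### Nonnegativity of the divergences -/

section Nonnegativity

variable {n : Type*} [Fintype n] [DecidableEq n]

lemma mlog_one : mlog (1 : Matrix n n ℂ) = 0 := by
  simp [mlog]

lemma mpow_one (r : ℝ) : mpow (1 : Matrix n n ℂ) r = 1 := by
  simp [mpow]

lemma Dalpha_one_unit (α : ℝ≥0∞) : 0 ≤ Dalpha α (1 : Matrix Unit Unit ℂ) 1 := by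
  unfold Dalpha
  split_ifs with h1 h2
  · simp [relEntropy, mlog_one]
  · exact le_iInf₂ fun t ht => EReal.coe_nonneg.2 ht.1
  · simp [sandwichedRenyi, mpow_one]

/-- Nonnegativity of `D_α` on states, by data processing under the trace. -/
lemma Dalpha_nonneg {α : ℝ≥0∞} (hα : 1 ≤ α) {ρ σ : Matrix n n ℂ} (hρ : IsState ρ)
    (hσ : IsState σ) : 0 ≤ Dalpha α ρ σ := by
  set K : n → Matrix Unit n ℂ := fun i => Matrix.single () i 1 with hKdef
  have hK : ∑ k, (K k).conjTranspose * K k = 1 := by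
    simp only [hKdef, Matrix.conjTranspose_single, star_one, Matrix.single_mul_single_same, mul_one]
    ext i j
    rcases eq_or_ne i j with rfl | h
    · simp [Matrix.sum_apply, Matrix.single_apply]
    · have : ∀ k, ¬ (k = i ∧ k = j) := fun k hk => h (hk.1.symm.trans hk.2)
      simp [Matrix.sum_apply, h, this]
  have hs : ∀ {X : Matrix n n ℂ}, IsState X → krausMap K X = 1 := by
    intro X hX
    ext i j
    have := trace_krausMap hK X
    rw [hX.2] at this
    simpa [Matrix.trace] using this
  have h := Dalpha_krausMap_le (t := 0) (τ := (1 : Matrix Unit Unit ℂ)) hK hα hρ hσ.1 .one le_rfl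
    (by rw [hs hσ]; simpa using Matrix.PosSemidef.zero)
  rw [hs hρ, EReal.coe_zero, zero_add] at h
  exact (Dalpha_one_unit α).trans h

end Nonnegativity

/-! ### Kraus operators of channels -/

section Kraus

/-- Kraus operators of a completely positive map, read off from a square root of its Choi
matrix. -/
lemma IsCompletelyPositive.exists_kraus {d : ℕ} {n : Type*} [Fintype n] [DecidableEq n]
    {T : Matrix (Fin d) (Fin d) ℂ →ₗ[ℂ] Matrix n n ℂ} (hT : IsCompletelyPositive T) :
    ∃ K : Fin d × n → Matrix n (Fin d) ℂ, ∀ X, T X = krausMap K X := by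
  set v : Fin d × Fin d → ℂ := fun p => if p.1 = p.2 then 1 else 0 with hv
  have hC := hT d _ (Matrix.posSemidef_vecMulVec_self_star v)
  set C := applyRight T (Matrix.vecMulVec v (star v)) with hCdef
  have hCapp : ∀ i j x y, C (i, x) (j, y) = T (Matrix.single i j 1) x y := by
    intro i j x y
    rw [hCdef]
    have h : (Matrix.of fun i' j' => Matrix.vecMulVec v (star v) (i, i') (j, j')) =
        Matrix.single i j 1 := by
      ext i' j'
      simp only [Matrix.of_apply, Matrix.vecMulVec_apply, hv, Pi.star_apply, Matrix.single_apply]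
      split_ifs <;> simp_all
    simp only [applyRight, Matrix.of_apply, h]
  have hS : suppPow hC (1 / 2) * (suppPow hC (1 / 2)).conjTranspose = C := by
    rw [suppPow_half_conjTranspose, suppPow_half_mul_suppPow_half]
  refine ⟨fun k => Matrix.of fun x i => suppPow hC (1 / 2) (i, x) k, fun X => ?_⟩
  ext x y
  have h1 : T X x y = ∑ i, ∑ j, X i j * C (i, x) (j, y) := by
    conv_lhs => rw [Matrix.matrix_eq_sum_single X]
    simp only [map_sum, Matrix.sum_apply]
    refine Finset.sum_congr rfl fun i _ => Finset.sum_congr rfl fun j _ => ?_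
    rw [hCapp, ← mul_one (X i j), ← smul_eq_mul (X i j) 1, ← Matrix.smul_single, map_smul]
    simp
  rw [h1]
  conv_lhs => rw [← hS]
  simp only [krausMap_apply, Matrix.sum_apply, Matrix.mul_apply, Matrix.conjTranspose_apply,
    Matrix.of_apply, Finset.sum_mul, Finset.mul_sum]
  conv_rhs => rw [Finset.sum_comm]
  rw [Finset.sum_comm]
  refine Finset.sum_congr rfl fun j _ => ?_
  rw [Finset.sum_comm]
  refine Finset.sum_congr rfl fun k _ => Finset.sum_congr rfl fun i _ => ?_
  ring

lemma sum_conjTranspose_mul_self_of_trace {m n κ : Type*} [Fintype m] [DecidableEq m] [Fintype n]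
    [DecidableEq n] [Fintype κ] {K : κ → Matrix n m ℂ}
    (h : ∀ X, (krausMap K X).trace = X.trace) : ∑ k, (K k).conjTranspose * K k = 1 := by
  refine Matrix.ext_iff_trace_mul_left.2 fun X => ?_
  have h1 := trace_mul_krausMap_adjoint K X 1
  rw [Matrix.mul_one, h, krausMap_apply] at h1
  simpa using h1

/-- The Kraus operator `1 ⊗ K ⊗ 1`, with the input grouped as `(R ⊗ m) ⊗ S` and the output as
`R ⊗ (n ⊗ S)`. -/
def middleKraus (R S : Type*) [DecidableEq R] [DecidableEq S] {m n : Type*} (K : Matrix n m ℂ) :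
    Matrix (R × n × S) ((R × m) × S) ℂ :=
  (((1 : Matrix R R ℂ) ⊗ₖ K) ⊗ₖ (1 : Matrix S S ℂ)).submatrix (Equiv.prodAssoc R n S).symm id

section

variable {R S m n κ : Type*} [Fintype R] [DecidableEq R] [Fintype S] [DecidableEq S] [Fintype m]
  [Fintype κ]

lemma krausMap_middleKraus_apply (K : κ → Matrix n m ℂ)
    (X : Matrix ((R × m) × S) ((R × m) × S) ℂ) (p q : R × n × S) :
    krausMap (fun k => middleKraus R S (K k)) X p q =
      krausMap K (Matrix.of fun i j => X ((p.1, i), p.2.2) ((q.1, j), q.2.2)) p.2.1 q.2.1 := by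
  obtain ⟨r, x, s⟩ := p
  obtain ⟨r', x', s'⟩ := q
  simp [krausMap_apply, middleKraus, Matrix.sum_apply, Matrix.mul_apply, Fintype.sum_prod_type,
    Matrix.one_apply, Finset.sum_mul, apply_ite (starRingEnd ℂ)]

omit [Fintype m] in
lemma sum_middleKraus [Fintype n] [DecidableEq m] {K : κ → Matrix n m ℂ}
    (hK : ∑ k, (K k).conjTranspose * K k = 1) :
    ∑ k, (middleKraus R S (K k)).conjTranspose * middleKraus R S (K k) = 1 := by
  have h : ∀ k, (middleKraus R S (K k)).conjTranspose * middleKraus R S (K k) =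
      ((1 : Matrix R R ℂ) ⊗ₖ ((K k).conjTranspose * K k)) ⊗ₖ (1 : Matrix S S ℂ) := by
    intro k
    unfold middleKraus
    rw [Matrix.conjTranspose_submatrix, Matrix.submatrix_mul_equiv, Matrix.submatrix_id_id,
      Matrix.conjTranspose_kronecker, Matrix.conjTranspose_kronecker,
      ← Matrix.mul_kronecker_mul, ← Matrix.mul_kronecker_mul]
    simp
  simp only [h]
  have h2 : ∑ k, ((1 : Matrix R R ℂ) ⊗ₖ ((K k).conjTranspose * K k)) ⊗ₖ (1 : Matrix S S ℂ) =
      ((1 : Matrix R R ℂ) ⊗ₖ (∑ k, (K k).conjTranspose * K k)) ⊗ₖ (1 : Matrix S S ℂ) := by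
    ext i j
    simp [Matrix.sum_apply, Finset.mul_sum, Finset.sum_mul]
  rw [h2, hK, Matrix.one_kronecker_one, Matrix.one_kronecker_one]

variable {K : κ → Matrix n m ℂ} {T : Matrix m m ℂ →ₗ[ℂ] Matrix n n ℂ}

lemma applyMiddle_eq_krausMap (hT : ∀ X, T X = krausMap K X)
    (X : Matrix (R × m × S) (R × m × S) ℂ) :
    applyMiddle T X = krausMap (fun k => middleKraus R S (K k))
      (X.submatrix (Equiv.prodAssoc R m S) (Equiv.prodAssoc R m S)) := by
  ext p q
  rw [krausMap_middleKraus_apply, ← hT]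
  rfl

lemma krausMap_middleKraus_kronecker (hT : ∀ X, T X = krausMap K X)
    (γ : Matrix (R × m) (R × m) ℂ) (φ : Matrix S S ℂ) :
    krausMap (fun k => middleKraus R S (K k)) (γ ⊗ₖ φ) =
      (applyRight T γ ⊗ₖ φ).submatrix (Equiv.prodAssoc R n S).symm
        (Equiv.prodAssoc R n S).symm := by
  ext p q
  rw [krausMap_middleKraus_apply, ← hT]
  have : (Matrix.of fun i j => (γ ⊗ₖ φ) ((p.1, i), p.2.2) ((q.1, j), q.2.2)) =
      φ p.2.2 q.2.2 • (Matrix.of fun i j => γ (p.1, i) (q.1, j)) := by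
    ext i j
    simp [mul_comm]
  rw [this, map_smul]
  simp [applyRight, mul_comm]

end

end Kraus

/-! ### Separable states -/

section Separable

variable {a b c : Type*} [Fintype a] [Fintype b] [Fintype c]

lemma IsState.kronecker [DecidableEq a] [DecidableEq b] {ρ : Matrix a a ℂ} {σ : Matrix b b ℂ}
    (hρ : IsState ρ) (hσ : IsState σ) : IsState (ρ ⊗ₖ σ) :=
  ⟨hρ.1.kronecker hσ.1, by rw [Matrix.trace_kronecker, hρ.2, hσ.2, mul_one]⟩

lemma isSeparable_of_fintype {ι : Type*} [Fintype ι] {p : ι → ℝ} {γ : ι → Matrix a a ℂ}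
    {φ : ι → Matrix b b ℂ} (hp : ∀ i, 0 ≤ p i) (hp1 : ∑ i, p i = 1) (hγ : ∀ i, IsState (γ i))
    (hφ : ∀ i, IsState (φ i)) : IsSeparable (∑ i, (p i : ℂ) • (γ i ⊗ₖ φ i)) := by
  let e := (Fintype.equivFin ι).symm
  refine ⟨Fintype.card ι, p ∘ e, γ ∘ e, φ ∘ e, fun i => hp _, ?_, fun i => hγ _, fun i => hφ _, ?_⟩
  · rw [← hp1]
    exact e.sum_comp p
  · exact (e.sum_comp fun i => (p i : ℂ) • (γ i ⊗ₖ φ i)).symm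

lemma IsSeparable.isState [DecidableEq a] [DecidableEq b] {σ : Matrix (a × b) (a × b) ℂ}
    (h : IsSeparable σ) : IsState σ := by
  obtain ⟨k, p, γ, φ, hp, hp1, hγ, hφ, rfl⟩ := h
  refine ⟨Matrix.posSemidef_sum _ fun i _ =>
    ((hγ i).kronecker (hφ i)).1.smul (Complex.zero_le_real.2 (hp i)), ?_⟩
  simp only [Matrix.trace_sum, Matrix.trace_smul, ((hγ _).kronecker (hφ _)).2, smul_eq_mul, mul_one]
  rw [← Complex.ofReal_sum, hp1, Complex.ofReal_one]

/-- Appending states on `c` to the `b` side of separable states, and mixing, keeps them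
separable. -/
lemma isSeparable_sum_kronecker [DecidableEq b] [DecidableEq c] {ι : Type*} [Fintype ι]
    {p : ι → ℝ} {σ : ι → Matrix (a × b) (a × b) ℂ} {φ : ι → Matrix c c ℂ}
    (hp : ∀ i, 0 ≤ p i) (hp1 : ∑ i, p i = 1)
    (hσ : ∀ i, IsSeparable (σ i)) (hφ : ∀ i, IsState (φ i)) :
    IsSeparable (∑ i, (p i : ℂ) • (σ i ⊗ₖ φ i).submatrix (Equiv.prodAssoc a b c).symm
      (Equiv.prodAssoc a b c).symm) := by
  choose k q α β hq hq1 hα hβ hσe using hσ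
  have h := isSeparable_of_fintype (ι := Σ i, Fin (k i)) (p := fun x => p x.1 * q x.1 x.2)
    (γ := fun x => α x.1 x.2) (φ := fun x => β x.1 x.2 ⊗ₖ φ x.1)
    (fun x => mul_nonneg (hp _) (hq _ _))
    (by simp only [Fintype.sum_sigma, ← Finset.mul_sum, hq1, mul_one, hp1])
    (fun x => hα _ _) (fun x => (hβ _ _).kronecker (hφ _))
  convert h using 1
  rw [Fintype.sum_sigma]
  refine Finset.sum_congr rfl fun i _ => ?_
  ext x y
  simp only [hσe i, Matrix.smul_apply, Matrix.submatrix_apply, Matrix.kroneckerMap_apply,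
    Matrix.sum_apply, smul_eq_mul, Finset.sum_mul, Finset.mul_sum, Equiv.prodAssoc_symm_apply]
  refine Finset.sum_congr rfl fun j _ => ?_
  push_cast
  ring

end Separable

/-! ### Entanglement of the channel output -/

section Channel

variable {dA dA' dB dB' : ℕ}
  {T : Matrix (Fin dA') (Fin dA') ℂ →ₗ[ℂ] Matrix (Fin dB') (Fin dB') ℂ}

/-- The infima in `Emax` and `Dmax` need not be known to be attained: any `l` strictly above
`EmaxChannel T` works as an exponent. -/
lemma exists_isSeparable_of_EmaxChannel_lt {l : ℝ} (h : EmaxChannel T < l)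
    {γ : Matrix (Fin dA × Fin dA') (Fin dA × Fin dA') ℂ} (hγ : IsState γ) :
    0 ≤ l ∧ ∃ σ : Matrix (Fin dA × Fin dB') (Fin dA × Fin dB') ℂ, IsSeparable σ ∧
      ((((2 : ℝ) ^ l : ℝ) : ℂ) • σ - applyRight T γ).PosSemidef := by
  have h1 : Emax (applyRight T γ) < l := lt_of_le_of_lt
    (le_iSup_of_le dA (le_iSup₂ (f := fun γ (_ : IsState γ) => Emax (applyRight T γ)) γ hγ)) h
  unfold Emax Dmax at h1
  simp only [iInf_lt_iff] at h1
  obtain ⟨σ, hσ, t, ⟨ht0, ht⟩, htl⟩ := h1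
  have htl' : t < l := EReal.coe_lt_coe_iff.1 htl
  refine ⟨ht0.trans htl'.le, σ, hσ, ?_⟩
  have hle : (0 : ℝ) ≤ 2 ^ l - 2 ^ t :=
    sub_nonneg.2 (Real.rpow_le_rpow_of_exponent_le one_le_two htl'.le)
  have h2 := (hσ.isState.1.smul (Complex.zero_le_real.2 hle)).add ht
  rwa [Complex.ofReal_sub, sub_smul, sub_add_sub_cancel] at h2

/-- The mixture `σ` of products `γ i ⊗ φ i` is mapped below `2 ^ l τ`, where `τ` is obtained by
replacing `γ i` by a separable state that dominates `(id ⊗ T)(γ i)` up to the factor `2 ^ l`. -/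
lemma Ealpha_applyMiddle_le (hT : IsChannel T)
    {ρ : Matrix (Fin dA × Fin dA' × Fin dB) (Fin dA × Fin dA' × Fin dB) ℂ}
    (hρ : IsState (ρ.submatrix (Equiv.prodAssoc (Fin dA) (Fin dA') (Fin dB))
            (Equiv.prodAssoc (Fin dA) (Fin dA') (Fin dB)))) {α : ℝ≥0∞} (hα : 1 ≤ α) {l : ℝ}
    (hl : EmaxChannel T < l)
    {σ : Matrix ((Fin dA × Fin dA') × Fin dB) ((Fin dA × Fin dA') × Fin dB) ℂ}
    (hσ : IsSeparable σ) :
    Ealpha (a := Fin dA) (b := Fin dB' × Fin dB) α (applyMiddle T ρ) ≤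
      l + Dalpha α (ρ.submatrix (Equiv.prodAssoc (Fin dA) (Fin dA') (Fin dB))
            (Equiv.prodAssoc (Fin dA) (Fin dA') (Fin dB))) σ := by
  obtain ⟨K, hTK⟩ := hT.1.exists_kraus
  have hK := sum_conjTranspose_mul_self_of_trace (K := K) fun X => by rw [← hTK, hT.2]
  have hσs := hσ.isState
  obtain ⟨k, p, γ, φ, hp, hp1, hγ, hφ, rfl⟩ := hσ
  choose hl0 ξ hξ hξT using fun i => exists_isSeparable_of_EmaxChannel_lt hl (hγ i)
  have hl0' : 0 ≤ l := by
    rcases isEmpty_or_nonempty (Fin k) with h | ⟨⟨i⟩⟩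
    · simp at hp1
    · exact hl0 i
  have hτ := isSeparable_sum_kronecker hp hp1 hξ hφ
  rw [applyMiddle_eq_krausMap hTK]
  refine (iInf₂_le _ hτ).trans (Dalpha_krausMap_le (sum_middleKraus hK) hα hρ hσs.1
    hτ.isState.1 hl0' ?_)
  rw [map_sum, Finset.smul_sum, ← Finset.sum_sub_distrib]
  refine Matrix.posSemidef_sum _ fun i _ => ?_
  have h1 := (((hξT i).kronecker (hφ i).1).submatrix
    (Equiv.prodAssoc (Fin dA) (Fin dB') (Fin dB)).symm).smul (Complex.zero_le_real.2 (hp i))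
  refine Eq.subst (motive := Matrix.PosSemidef) ?_ h1
  rw [map_smul, krausMap_middleKraus_kronecker hTK]
  ext x y
  simp
  ring

lemma EmaxChannel_nonneg {γ : Matrix (Fin dA × Fin dA') (Fin dA × Fin dA') ℂ} (hγ : IsState γ) :
    0 ≤ EmaxChannel T := by
  refine le_trans ?_ (le_iSup_of_le dA
    (le_iSup₂ (f := fun γ (_ : IsState γ) => Emax (applyRight T γ)) γ hγ))
  exact le_iInf₂ fun _ _ => le_iInf₂ fun t ht => EReal.coe_nonneg.2 ht.1

lemma isState_single {n : Type*} [Fintype n] [DecidableEq n] (i : n) :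
    IsState (Matrix.single i i (1 : ℂ)) := by
  refine ⟨?_, by simp⟩
  rw [← Matrix.diagonal_single]
  exact Matrix.PosSemidef.diagonal (Pi.single_nonneg.2 zero_le_one)

end Channel

end QEnt

/-- The state `ρ` lives on `A ⊗ A' ⊗ B`. On the left, `T` acts on `A'` and the bipartition
is `A : B'B`; on the right, `ρ` is regrouped as `(A ⊗ A') ⊗ B`. -/
theorem theorem2 (dA dA' dB dB' : ℕ)
    (T : Matrix (Fin dA') (Fin dA') ℂ →ₗ[ℂ] Matrix (Fin dB') (Fin dB') ℂ)
    (hT : QEnt.IsChannel T)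
    (ρ : Matrix (Fin dA × Fin dA' × Fin dB) (Fin dA × Fin dA' × Fin dB) ℂ)
    (hρ : QEnt.IsState ρ) (α : ℝ≥0∞) (hα : 1 ≤ α) :
    QEnt.Ealpha (a := Fin dA) (b := Fin dB' × Fin dB) α (QEnt.applyMiddle T ρ) ≤
      QEnt.EmaxChannel T +
        QEnt.Ealpha (a := Fin dA × Fin dA') (b := Fin dB) α
          (ρ.submatrix (Equiv.prodAssoc (Fin dA) (Fin dA') (Fin dB))
            (Equiv.prodAssoc (Fin dA) (Fin dA') (Fin dB))) := by
  have hρ' : QEnt.IsState (ρ.submatrix (Equiv.prodAssoc (Fin dA) (Fin dA') (Fin dB))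
      (Equiv.prodAssoc (Fin dA) (Fin dA') (Fin dB))) := by
    refine ⟨hρ.1.submatrix _, ?_⟩
    rw [← hρ.2]
    exact (Equiv.prodAssoc (Fin dA) (Fin dA') (Fin dB)).sum_comp fun i => ρ i i
  have hE : 0 ≤ QEnt.EmaxChannel T := by
    have hne : Nonempty (Fin dA × Fin dA' × Fin dB) := by
      by_contra h
      rw [not_nonempty_iff] at h
      have := hρ.2
      simp [Matrix.trace] at this
    obtain ⟨i⟩ := hne
    exact QEnt.EmaxChannel_nonneg (QEnt.isState_single (i.1, i.2.1))
  have hF : 0 ≤ QEnt.Ealpha (a := Fin dA × Fin dA') (b := Fin dB) α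
      (ρ.submatrix (Equiv.prodAssoc (Fin dA) (Fin dA') (Fin dB))
        (Equiv.prodAssoc (Fin dA) (Fin dA') (Fin dB))) :=
    le_iInf₂ fun σ hσ => QEnt.Dalpha_nonneg hα hρ' hσ.isState
  have key : ∀ l : ℝ, QEnt.EmaxChannel T < l →
      QEnt.Ealpha (a := Fin dA) (b := Fin dB' × Fin dB) α (QEnt.applyMiddle T ρ) ≤
      l + QEnt.Ealpha (a := Fin dA × Fin dA') (b := Fin dB) α
          (ρ.submatrix (Equiv.prodAssoc (Fin dA) (Fin dA') (Fin dB))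
            (Equiv.prodAssoc (Fin dA) (Fin dA') (Fin dB))) := by
    intro l hl
    rw [add_comm, ← EReal.sub_le_iff_le_add (by simp) (by simp)]
    refine le_iInf₂ fun σ hσ => ?_
    rw [EReal.sub_le_iff_le_add (by simp) (by simp), add_comm]
    exact QEnt.Ealpha_applyMiddle_le hT hρ' hα hl hσ
  generalize QEnt.EmaxChannel T = E at *
  generalize QEnt.Ealpha (a := Fin dA × Fin dA') (b := Fin dB) α _ = F at *
  -- `0 ≤ E` and `0 ≤ F` rule out `⊥`, so that no sum `⊤ + ⊥ = ⊥` can occur.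
  induction E with
  | bot => simp at hE
  | top => rw [EReal.top_add_of_ne_bot (fun h => by simp [h] at hF)]; exact le_top
  | coe e =>
    induction F with
    | bot => simp at hF
    | top => rw [EReal.coe_add_top]; exact le_top
    | coe f =>
      refine EReal.le_of_forall_lt_iff_le.1 fun z hz => ?_
      rw [← EReal.coe_add, EReal.coe_lt_coe_iff] at hz
      have := key (z - f) (EReal.coe_lt_coe_iff.2 (by linarith))
      rwa [← EReal.coe_add, sub_add_cancel] at this
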